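/- Let $(\mathcal X,\mathcal A)$ be a measurable space, let $P$ be a probability distribution on $\mathcal X\times\mathbb R$, and let $(X,Y)\sim P$ with $\mathbb E[Y^2]<\infty$. For measurable $f:\mathcal X\to\mathbb R$ put $R(f)=\mathbb E[(Y-f(X))^2]$. Let $\varphi_1,\dots,\varphi_d:\mathcal X\to\mathbb R$ be measurable with $\mathbb E[\varphi_j(X)^2]<\infty$, and for $\theta\in\mathbb R^d$ let $f_\theta=\sum_{j=1}^d\theta_j\varphi_j$. Let $\Theta\subset\mathbb R^d$ be nonempty, closed, convex and bounded, $\mathcal F=\{f_\theta:\theta\in\Theta\}$, $\mathcal F_{\rm lin}=\{f_\theta:\theta\in\mathbb R^d\}$, and let $f^*\in\operatorname{argmin}_{f\in\mathcal F}R(f)$. Let $\pi$ be the uniform distribution on $\mathcal F$, that is, the image under $\theta\mapsto f_\theta$ of the normalized Lebesgue measure on $\Theta$ (if $\Theta$ has empty interior, the Lebesgue measure of its affine hull is used). Let $n\ge1$, let $(X_1,Y_1),\dots,(X_n,Y_n)$ be i.i.d. with distribution $P$, and let $\lambda>0$. Put $$W_i(f,f')=\lambda\{[Y_i-f(X_i)]^2-[Y_i-f'(X_i)]^2\},\qquad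 \hat{\mathcal E}(f)=\log\int\frac{\pi(df')}{\prod_{i=1}^n\left[1-W_i(f,f')+\frac12W_i(f,f')^2\right]},$$ and let $\hat\pi$ be the (data-dependent) distribution on $\mathcal F$ with density $$\frac{d\hat\pi}{d\pi}(f)=\frac{\exp[-\hat{\mathcal E}(f)]}{\int\exp[-\hat{\mathcal E}(f')]\,\pi(df')}.$$ Given the data, draw $\hat f$ from $\hat\pi$. Assume that for some real $H$ $$\sup_{f_1,f_2\in\mathcal F,\;x\in\mathcal X}|f_1(x)-f_2(x)|\le H,$$ and that for some $\sigma>0$, almost surely, $\mathbb E\{[Y-f^*(X)]^2\mid X\}\le\sigma^2$. **Theorem.** 1. Let $\eta=\lambda(2\sigma+H)^2$. For every $0<\eta'<1-\eta$ and every $\varepsilon>0$, with probability at least $1-\varepsilon$ with respect to the joint law $P^{\otimes n}\hat\pi$ of the observations and of $\hat f$, $$R(\hat f)-R(f^*)\le(2\sigma+H)^2\,\frac{C_1d+C_2\log(2\varepsilon^{-1})}{n},$$ where $$C_1=\frac{\log\left(\frac{(1+\eta)^2}{\eta'(1-\eta)}\right)}{\eta(1-\eta-\eta')},\qquad C_2=\frac{2}{\eta(1-\eta-\eta')}.$$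 2. If $\lambda=0.32(2\sigma+H)^{-2}$, then for every $\varepsilon>0$, with probability at least $1-\varepsilon$, $$R(\hat f)-R(f^*)\le(2\sigma+H)^2\,\frac{16.6\,d+12.5\log(2\varepsilon^{-1})}{n}.$$ 3. If $\lambda=0.32(2\sigma+H)^{-2}$ and moreover $f^*\in\operatorname{argmin}_{f\in\mathcal F_{\rm lin}}R(f)$, then for every $\varepsilon>0$, with probability at least $1-\varepsilon$, $$R(\hat f)-R(f^*)\le(2\sigma+H)^2\,\frac{8.3\,d+12.5\log(2\varepsilon^{-1})}{n}.$$ -/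

import Mathlib

namespace PacBayesLS

open MeasureTheory ProbabilityTheory

variable {𝒳 : Type*} {d n : ℕ}

/-- The prediction function `f_θ = ∑ j, θ j • φ j`. -/
def linComb (φ : Fin d → 𝒳 → ℝ) (θ : Fin d → ℝ) : 𝒳 → ℝ :=
  fun x => ∑ j, θ j * φ j x

/-- The least squares risk `R(f) = 𝔼 [(Y - f(X))²]` for `(X, Y) ∼ P`. -/
noncomputable def risk [MeasurableSpace 𝒳] (P : Measure (𝒳 × ℝ)) (f : 𝒳 → ℝ) : ℝ :=
  ∫ z, (z.2 - f z.1) ^ 2 ∂P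

/-- The scaled loss difference `W(f, f') = λ ((y - f(x))² - (y - f'(x))²)` at the data point
`z = (x, y)`. -/
def lossDiff (lam : ℝ) (z : 𝒳 × ℝ) (f f' : 𝒳 → ℝ) : ℝ :=
  lam * ((z.2 - f z.1) ^ 2 - (z.2 - f' z.1) ^ 2)

/-- The uniform distribution on `Θ ⊆ ℝ^d`: Lebesgue measure on `Θ`, renormalized to have mass one.
It is written with the Hausdorff measure in the dimension of the affine hull of `Θ`, which on
that hull is a constant multiple of its Lebesgue measure, so that convex sets with empty interior
(such as the probability simplex) are covered too. If `Θ` has positive `d`-dimensional volume, this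
is the normalized restriction of the Lebesgue measure of `ℝ^d`: see
`uniformDistribution_eq_cond_volume`. -/
noncomputable def uniformDistribution (Θ : Set (Fin d → ℝ)) : Measure (Fin d → ℝ) :=
  cond (Measure.hausdorffMeasure (Module.finrank ℝ (vectorSpan ℝ Θ) : ℝ)) Θ

theorem uniformDistribution_eq_cond_volume (Θ : Set (Fin d → ℝ)) (hΘ : volume Θ ≠ 0) :
    uniformDistribution Θ = cond volume Θ := by
  have hspan : affineSpan ℝ Θ = ⊤ := by
    by_contra h
    exact hΘ (measure_mono_null (subset_affineSpan ℝ Θ)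
      (Measure.addHaar_affineSubspace volume _ h))
  have hv : vectorSpan ℝ Θ = ⊤ := by
    rw [← direction_affineSpan, hspan, AffineSubspace.direction_top]
  have hk : Module.finrank ℝ (vectorSpan ℝ Θ) = Fintype.card (Fin d) := by
    rw [hv, finrank_top, Module.finrank_fintype_fun_eq_card]
  unfold uniformDistribution
  rw [hk, hausdorffMeasure_pi_real]

/-- `exp 𝓔̂(f_θ) = ∫ π(df') / ∏ i, (1 - W_i(f_θ, f') + W_i(f_θ, f')² / 2)`, where `π` is the uniform
distribution on the model, parametrized by `Θ`, and `z` is the sample. -/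
noncomputable def expEHat (lam : ℝ) (φ : Fin d → 𝒳 → ℝ) (Θ : Set (Fin d → ℝ))
    (z : Fin n → 𝒳 × ℝ) (θ : Fin d → ℝ) : ℝ :=
  ∫ θ', 1 / ∏ i, (1 - lossDiff lam (z i) (linComb φ θ) (linComb φ θ')
    + (1 / 2) * lossDiff lam (z i) (linComb φ θ) (linComb φ θ') ^ 2) ∂(uniformDistribution Θ)

/-- `𝓔̂(f_θ)`, the logarithm of the integral above. -/
noncomputable def eHat (lam : ℝ) (φ : Fin d → 𝒳 → ℝ) (Θ : Set (Fin d → ℝ))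
    (z : Fin n → 𝒳 × ℝ) (θ : Fin d → ℝ) : ℝ :=
  Real.log (expEHat lam φ Θ z θ)

/-- The density `dπ̂/dπ (f_θ) = exp(-𝓔̂(f_θ)) / ∫ exp(-𝓔̂(f')) π(df')`. -/
noncomputable def posteriorDensity (lam : ℝ) (φ : Fin d → 𝒳 → ℝ) (Θ : Set (Fin d → ℝ))
    (z : Fin n → 𝒳 × ℝ) (θ : Fin d → ℝ) : ℝ :=
  Real.exp (-eHat lam φ Θ z θ) / ∫ θ', Real.exp (-eHat lam φ Θ z θ') ∂(uniformDistribution Θ)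

theorem measurable_posteriorDensity [MeasurableSpace 𝒳] (lam : ℝ) (φ : Fin d → 𝒳 → ℝ)
    (hφ : ∀ j, Measurable (φ j)) (Θ : Set (Fin d → ℝ)) :
    Measurable (Function.uncurry (posteriorDensity (n := n) lam φ Θ)) := by
  have hlin : ∀ i : Fin n, Measurable
      (fun q : ((Fin n → 𝒳 × ℝ) × (Fin d → ℝ)) => linComb φ q.2 (q.1 i).1) := by
    intro i
    unfold linComb
    refine Finset.measurable_sum _ fun j _ => ?_
    have h1 : Measurable (fun q : ((Fin n → 𝒳 × ℝ) × (Fin d → ℝ)) => (q.1 i).1) :=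
      ((measurable_pi_apply i).comp measurable_fst).fst
    exact ((measurable_pi_apply j).comp measurable_snd).mul ((hφ j).comp h1)
  have hE : Measurable (Function.uncurry (expEHat (n := n) lam φ Θ)) := by
    have hy : ∀ i : Fin n, Measurable
        (fun q : ((Fin n → 𝒳 × ℝ) × (Fin d → ℝ)) × (Fin d → ℝ) => (q.1.1 i).2) := fun i =>
      ((measurable_pi_apply i).comp (measurable_fst.comp measurable_fst)).snd
    have hW : ∀ i : Fin n, Measurable
        (fun q : ((Fin n → 𝒳 × ℝ) × (Fin d → ℝ)) × (Fin d → ℝ) =>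
          lossDiff lam (q.1.1 i) (linComb φ q.1.2) (linComb φ q.2)) := by
      intro i
      have h1 : Measurable (fun q : ((Fin n → 𝒳 × ℝ) × (Fin d → ℝ)) × (Fin d → ℝ) => q.1) :=
        measurable_fst
      have h1' : Measurable
          (fun q : ((Fin n → 𝒳 × ℝ) × (Fin d → ℝ)) × (Fin d → ℝ) => (q.1.1, q.2)) :=
        (measurable_fst.comp measurable_fst).prodMk measurable_snd
      have h2 := (hlin i).comp h1
      have h3 := (hlin i).comp h1'
      exact ((((hy i).sub h2).pow_const 2).sub (((hy i).sub h3).pow_const 2)).const_mul lam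
    have hI : Measurable (fun q : ((Fin n → 𝒳 × ℝ) × (Fin d → ℝ)) × (Fin d → ℝ) =>
        1 / ∏ i, (1 - lossDiff lam (q.1.1 i) (linComb φ q.1.2) (linComb φ q.2)
          + (1 / 2) * lossDiff lam (q.1.1 i) (linComb φ q.1.2) (linComb φ q.2) ^ 2)) :=
      measurable_const.div (Finset.measurable_prod _ fun i _ =>
        (measurable_const.sub (hW i)).add (((hW i).pow_const 2).const_mul _))
    exact (hI.stronglyMeasurable.integral_prod_right (ν := cond _ Θ)).measurable
  have hexp : Measurable (fun q : (Fin n → 𝒳 × ℝ) × (Fin d → ℝ) =>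
      Real.exp (-eHat lam φ Θ q.1 q.2)) :=
    Real.measurable_exp.comp (Real.measurable_log.comp hE).neg
  have hden : Measurable (fun z : Fin n → 𝒳 × ℝ =>
      ∫ θ', Real.exp (-eHat lam φ Θ z θ') ∂(uniformDistribution Θ)) :=
    (hexp.stronglyMeasurable.integral_prod_right (ν := cond _ Θ)).measurable
  exact hexp.div (hden.comp measurable_fst)

/-- The randomized estimator: the kernel that sends a sample `z` to the posterior distribution `π̂`
(of the parameter `θ` of the drawn prediction function `f_θ`), which has density
`posteriorDensity` with respect to the uniform distribution. -/
noncomputable def posterior [MeasurableSpace 𝒳] (n : ℕ) (lam : ℝ) (φ : Fin d → 𝒳 → ℝ)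
    (hφ : ∀ j, Measurable (φ j)) (Θ : Set (Fin d → ℝ)) :
    Kernel (Fin n → 𝒳 × ℝ) (Fin d → ℝ) where
  toFun z := (uniformDistribution Θ).withDensity
    (fun θ => ENNReal.ofReal (posteriorDensity lam φ Θ z θ))
  measurable' := by
    have hm := (measurable_posteriorDensity (n := n) lam φ hφ Θ).ennreal_ofReal
    refine Measure.measurable_of_measurable_coe _ fun s hs => ?_
    simp_rw [withDensity_apply _ hs, uniformDistribution]
    exact hm.lintegral_prod_right'

/-- The joint law `P^{⊗n} π̂` of the sample and of the parameter drawn from the posterior. -/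
noncomputable def jointLaw [MeasurableSpace 𝒳] (P : Measure (𝒳 × ℝ)) (n : ℕ) (lam : ℝ)
    (φ : Fin d → 𝒳 → ℝ) (hφ : ∀ j, Measurable (φ j)) (Θ : Set (Fin d → ℝ)) :
    Measure ((Fin n → 𝒳 × ℝ) × (Fin d → ℝ)) :=
  (Measure.pi fun _ : Fin n => P).compProd (posterior n lam φ hφ Θ)

end PacBayesLS

open MeasureTheory PacBayesLS

/-! Write `D` for the excess risk over `f*`, `L(s) = ∫ exp(-s D) dπ`, `G(θ, θ')` for the product of
the factors `1 - W + W² / 2`, `C(θ) = ∫ π(dθ') / G(θ, θ')` and `Z = ∫ dπ / C`, so that the posterior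
has density `1 / (Z C)`.

Second moments suffice to control `G`: since `f*` minimizes the risk on a convex set, the squared
distance from `f` to `f*` is at most `D`, whence `𝔼 W(f, f*)² ≤ λ η D`. This gives `𝔼 G(θ, θ') ≤
exp(-a D(θ) + b D(θ'))` with `a = λ n (1 - η)` and `b = λ n (1 + η)`
(`lintegral_sampleTruncation_le`).

Two facts turn this into bounds on inverses: `1 / G(θ, θ') ≤ G(θ', θ)`, and a weighted
Cauchy–Schwarz inequality that bounds `1 / ∫ F⁻¹` by an integral linear in `F`. They yield `𝔼 [1 /
C(θ)] ≤ exp(-a D(θ)) / L(b)` and `𝔼 [1 / Z] ≤ L(a) / L(b)`. As `Z` cancels in the posterior density,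
`𝔼 ∫ Z exp(c D) dπ̂ ≤ L(a - c) / L(b)`. A Markov argument combining the last two bounds eliminates
`Z` and controls `D` under the joint law (`compProd_deviation_le`).

The dimension enters through the ratios of Laplace transforms. Contracting `Θ` towards `θ*` by `a /
b` multiplies the convex function `D` by at most `a / b` and costs a Jacobian at most `(b / a) ^ d`.
If `f*` minimizes the risk on the whole span, `D` is exactly quadratic, a contraction by `√(a / b)`
suffices, and `d` becomes `d / 2`. -/

namespace PacBayesLS

open MeasureTheory ProbabilityTheory
open scoped ENNReal

/-! ### Weighted Cauchy–Schwarz inequality and Laplace transforms -/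

/-- Cauchy–Schwarz inequality with a weight `F`. -/
theorem sq_lintegral_le {T : Type*} [MeasurableSpace T] (μ : Measure T) {w F : T → ℝ≥0∞}
    (hw : AEMeasurable w μ) (hF : AEMeasurable F μ) (hF0 : ∀ x, F x ≠ 0) (hFt : ∀ x, F x ≠ ∞) :
    (∫⁻ x, w x ∂μ) ^ 2 ≤ (∫⁻ x, w x ^ 2 * F x ∂μ) * ∫⁻ x, (F x)⁻¹ ∂μ := by
  -- Factor `w = (w F^{1/2}) · F^{-1/2}`.
  have h := ENNReal.lintegral_mul_le_Lp_mul_Lq μ Real.HolderConjugate.two_two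
    (hw.mul (hF.pow_const (1 / 2 : ℝ))) (hF.inv.pow_const (1 / 2 : ℝ))
  have e1 : ∀ x, ((w * fun x => F x ^ (1 / 2 : ℝ)) * fun x => (F x)⁻¹ ^ (1 / 2 : ℝ)) x = w x := by
    intro x
    simp only [Pi.mul_apply]
    rw [mul_assoc, ← ENNReal.mul_rpow_of_nonneg _ _ (by norm_num),
      ENNReal.mul_inv_cancel (hF0 x) (hFt x), ENNReal.one_rpow, mul_one]
  have e2 : ∀ x, ((w * fun x => F x ^ (1 / 2 : ℝ)) x) ^ (2 : ℝ) = w x ^ 2 * F x := by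
    intro x
    simp only [Pi.mul_apply]
    rw [ENNReal.mul_rpow_of_nonneg _ _ (by norm_num), ← ENNReal.rpow_mul]
    norm_num
  have e3 : ∀ x, ((F x)⁻¹ ^ (1 / 2 : ℝ)) ^ (2 : ℝ) = (F x)⁻¹ := by
    intro x
    rw [← ENNReal.rpow_mul]
    norm_num
  simp only [Pi.inv_apply] at h
  simp_rw [e1, e2, e3] at h
  calc (∫⁻ x, w x ∂μ) ^ 2 ≤ _ := pow_le_pow_left' h 2
    _ = _ := by
      rw [mul_pow, ← ENNReal.rpow_natCast, ← ENNReal.rpow_natCast, ← ENNReal.rpow_mul,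
        ← ENNReal.rpow_mul]
      norm_num

/-- A weighted form of Jensen's inequality for the inverse. -/
theorem inv_lintegral_inv_le {T : Type*} [MeasurableSpace T] (μ : Measure T) {w F : T → ℝ≥0∞}
    (hw : AEMeasurable w μ) (hF : AEMeasurable F μ) (hF0 : ∀ x, F x ≠ 0) (hFt : ∀ x, F x ≠ ∞)
    (hw0 : ∫⁻ x, w x ∂μ ≠ 0) (hwt : ∫⁻ x, w x ∂μ ≠ ∞) :
    (∫⁻ x, (F x)⁻¹ ∂μ)⁻¹ ≤ ((∫⁻ x, w x ∂μ) ^ 2)⁻¹ * ∫⁻ x, w x ^ 2 * F x ∂μ := by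
  have h := sq_lintegral_le μ hw hF hF0 hFt
  set N := ∫⁻ x, w x ∂μ
  set A := ∫⁻ x, w x ^ 2 * F x ∂μ
  set B := ∫⁻ x, (F x)⁻¹ ∂μ
  have hN0 : N ^ 2 ≠ 0 := pow_ne_zero _ hw0
  have hNt : N ^ 2 ≠ ∞ := ENNReal.pow_ne_top hwt
  rcases eq_or_ne B ∞ with hB | hB
  · simp [hB]
  have hB0 : B ≠ 0 := by
    intro hB0
    rw [hB0, mul_zero] at h
    exact hN0 (le_antisymm h zero_le)
  rw [← ENNReal.div_eq_inv_mul, ENNReal.le_div_iff_mul_le (Or.inl hN0) (Or.inl hNt), mul_comm,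
    ← div_eq_mul_inv]
  exact ENNReal.div_le_of_le_mul h

/-- The Laplace transform of `D` under `π`. -/
noncomputable def laplace {T : Type*} [MeasurableSpace T] (π : Measure T) (D : T → ℝ) (s : ℝ) :
    ℝ≥0∞ :=
  ∫⁻ θ, ENNReal.ofReal (Real.exp (-(s * D θ))) ∂π

theorem lintegral_ne_zero_of_ne_zero {T : Type*} [MeasurableSpace T] {π : Measure T} [NeZero π]
    {f : T → ℝ≥0∞} (hf : Measurable f) (h : ∀ x, f x ≠ 0) : ∫⁻ x, f x ∂π ≠ 0 := by
  rw [Ne, lintegral_eq_zero_iff hf]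
  intro h0
  obtain ⟨x, hx⟩ := h0.exists
  exact h x hx

theorem laplace_ne_zero {T : Type*} [MeasurableSpace T] (π : Measure T) [IsProbabilityMeasure π]
    {D : T → ℝ} (hD : Measurable D) (s : ℝ) : laplace π D s ≠ 0 :=
  lintegral_ne_zero_of_ne_zero (by fun_prop) fun x => by
    simpa using Real.exp_pos _

theorem laplace_ne_top {T : Type*} [MeasurableSpace T] (π : Measure T) [IsProbabilityMeasure π]
    {D : T → ℝ} (hD0 : ∀ᵐ θ ∂π, 0 ≤ D θ) {s : ℝ} (hs : 0 ≤ s) : laplace π D s ≠ ∞ := by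
  refine ne_top_of_le_ne_top ENNReal.one_ne_top ?_
  calc laplace π D s ≤ ∫⁻ _, 1 ∂π := by
        refine lintegral_mono_ae (hD0.mono fun θ hθ => ?_)
        rw [← ENNReal.ofReal_one]
        refine ENNReal.ofReal_le_ofReal (Real.exp_le_one_iff.2 ?_)
        nlinarith [mul_nonneg hs hθ]
    _ = 1 := by simp

/-! ### Abstract deviation bound for posteriors inversely proportional to a criterion -/

section Deviation

variable {S T : Type*} [MeasurableSpace T]

/-- The integral of the inverse of `G` with respect to its last argument: the exponential of the
empirical criterion. -/
noncomputable def criterion (π : Measure T) (G : S → T → T → ℝ≥0∞) (z : S) (θ : T) : ℝ≥0∞ :=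
  ∫⁻ θ', (G z θ θ')⁻¹ ∂π

/-- The normalizing constant of the posterior with density proportional to the inverse of the
criterion. -/
noncomputable def partition (π : Measure T) (G : S → T → T → ℝ≥0∞) (z : S) : ℝ≥0∞ :=
  ∫⁻ θ, (criterion π G z θ)⁻¹ ∂π

theorem criterion_ne_top (π : Measure T) [IsProbabilityMeasure π] {G : S → T → T → ℝ≥0∞}
    {m : ℝ≥0∞} (hm : m ≠ 0) (hGm : ∀ z θ θ', m ≤ G z θ θ') (z : S) (θ : T) :
    criterion π G z θ ≠ ∞ := by
  refine ne_top_of_le_ne_top (ENNReal.inv_ne_top.2 hm) ?_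
  calc criterion π G z θ ≤ ∫⁻ _, m⁻¹ ∂π :=
        lintegral_mono fun θ' => ENNReal.inv_le_inv.2 (hGm z θ θ')
    _ = m⁻¹ := by simp

variable [MeasurableSpace S]

theorem measurable_criterion (π : Measure T) [SFinite π] {G : S → T → T → ℝ≥0∞}
    (hG : Measurable fun q : (S × T) × T => G q.1.1 q.1.2 q.2) :
    Measurable fun q : S × T => criterion π G q.1 q.2 :=
  Measurable.lintegral_prod_right' (f := fun q : (S × T) × T => (G q.1.1 q.1.2 q.2)⁻¹) hG.inv

theorem measurable_partition (π : Measure T) [SFinite π] {G : S → T → T → ℝ≥0∞}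
    (hG : Measurable fun q : (S × T) × T => G q.1.1 q.1.2 q.2) :
    Measurable (partition π G) :=
  Measurable.lintegral_prod_right' (f := fun q : S × T => (criterion π G q.1 q.2)⁻¹)
    (measurable_criterion π hG).inv

theorem criterion_ne_zero (π : Measure T) [IsProbabilityMeasure π] {G : S → T → T → ℝ≥0∞}
    (hG : Measurable fun q : (S × T) × T => G q.1.1 q.1.2 q.2)
    (hGt : ∀ z θ θ', G z θ θ' ≠ ∞) (z : S) (θ : T) : criterion π G z θ ≠ 0 := by
  have h1 : Measurable fun θ' => G z θ θ' :=
    hG.comp (g := fun q : (S × T) × T => G q.1.1 q.1.2 q.2) (f := fun θ' => ((z, θ), θ'))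
      (by fun_prop)
  exact lintegral_ne_zero_of_ne_zero h1.inv fun θ' => ENNReal.inv_ne_zero.2 (hGt z θ θ')

variable {Q : Measure S} [IsProbabilityMeasure Q] {π : Measure T} [IsProbabilityMeasure π]
  {G : S → T → T → ℝ≥0∞} {m : ℝ≥0∞} {D : T → ℝ} {a b : ℝ}

/-- With the weight `w = exp(-x)`, the square in `w² F` absorbs a growth `exp(x)` of `F` and leaves
exactly one copy of `w`. -/
theorem ofReal_exp_sq_mul (x y : ℝ) :
    ENNReal.ofReal (Real.exp (-x)) ^ 2 * ENNReal.ofReal (Real.exp (y + x))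
      = ENNReal.ofReal (Real.exp y) * ENNReal.ofReal (Real.exp (-x)) := by
  rw [← ENNReal.ofReal_pow (Real.exp_pos _).le, ← ENNReal.ofReal_mul (by positivity),
    ← ENNReal.ofReal_mul (by positivity), ← Real.exp_nat_mul, ← Real.exp_add, ← Real.exp_add]
  congr 2
  push_cast
  ring

theorem inv_sq_mul_mul_self {N : ℝ≥0∞} (h0 : N ≠ 0) (ht : N ≠ ∞) (x : ℝ≥0∞) :
    (N ^ 2)⁻¹ * (x * N) = N⁻¹ * x := by
  rw [pow_two, ENNReal.mul_inv (Or.inl h0) (Or.inl ht), mul_comm x, ← mul_assoc, mul_assoc N⁻¹,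
    ENNReal.inv_mul_cancel h0 ht, mul_one]

/-- The expectation of the inverse of the criterion. -/
theorem lintegral_inv_criterion_le
    (hG : Measurable fun q : (S × T) × T => G q.1.1 q.1.2 q.2)
    (hGt : ∀ z θ θ', G z θ θ' ≠ ∞) (hm : m ≠ 0) (hGm : ∀ z θ θ', m ≤ G z θ θ')
    (hD : Measurable D) (hD0 : ∀ᵐ θ ∂π, 0 ≤ D θ) (hb : 0 ≤ b)
    (hE : ∀ᵐ θ ∂π, ∀ᵐ θ' ∂π,
      ∫⁻ z, G z θ θ' ∂Q ≤ ENNReal.ofReal (Real.exp (-(a * D θ) + b * D θ'))) :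
    ∀ᵐ θ ∂π, ∫⁻ z, (criterion π G z θ)⁻¹ ∂Q
      ≤ (laplace π D b)⁻¹ * ENNReal.ofReal (Real.exp (-(a * D θ))) := by
  have hN0 := laplace_ne_zero π hD b
  have hNt := laplace_ne_top π hD0 hb
  filter_upwards [hE] with θ hθ
  have hGθ : Measurable fun q : S × T => G q.1 θ q.2 :=
    hG.comp (g := fun q : (S × T) × T => G q.1.1 q.1.2 q.2) (f := fun q : S × T => ((q.1, θ), q.2))
      (by fun_prop)
  -- The weight matches the growth `exp(b D(θ'))` of the expectation of `G`, so the integral on the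
  -- right collapses to a multiple of `∫ w = L(b)`, which cancels one of the two factors `L(b)` in
  -- the denominator.
  set w : T → ℝ≥0∞ := fun θ' => ENNReal.ofReal (Real.exp (-(b * D θ'))) with hw
  have hwm : Measurable w := by fun_prop
  calc ∫⁻ z, (criterion π G z θ)⁻¹ ∂Q
      ≤ ∫⁻ z, ((laplace π D b) ^ 2)⁻¹ * ∫⁻ θ', w θ' ^ 2 * G z θ θ' ∂π ∂Q := by
        refine lintegral_mono fun z => ?_
        exact inv_lintegral_inv_le π hwm.aemeasurable
          (hGθ.comp (measurable_prodMk_left (x := z))).aemeasurable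
          (fun θ' => (pos_of_ne_zero hm |>.trans_le (hGm z θ θ')).ne') (fun θ' => hGt z θ θ') hN0 hNt
    _ = ((laplace π D b) ^ 2)⁻¹ * ∫⁻ θ', w θ' ^ 2 * ∫⁻ z, G z θ θ' ∂Q ∂π := by
        have hm2 : Measurable fun q : S × T => w q.2 ^ 2 * G q.1 θ q.2 :=
          ((hwm.comp measurable_snd).pow_const 2).mul hGθ
        rw [lintegral_const_mul _ (hm2.lintegral_prod_right'),
          lintegral_lintegral_swap hm2.aemeasurable]
        congr 1
        refine lintegral_congr fun θ' => ?_
        exact lintegral_const_mul (f := fun z => G z θ θ') (w θ' ^ 2)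
          (hGθ.comp (measurable_prodMk_right (y := θ')))
    _ ≤ ((laplace π D b) ^ 2)⁻¹ *
          ∫⁻ θ', ENNReal.ofReal (Real.exp (-(a * D θ))) * w θ' ∂π := by
        refine mul_le_mul' le_rfl (lintegral_mono_ae (hθ.mono fun θ' hθ' => ?_))
        rw [← ofReal_exp_sq_mul]
        gcongr
    _ = (laplace π D b)⁻¹ * ENNReal.ofReal (Real.exp (-(a * D θ))) := by
        rw [lintegral_const_mul _ hwm]
        exact inv_sq_mul_mul_self hN0 hNt _

/-- The expectation of the inverse of the normalizing constant. -/
theorem lintegral_inv_partition_le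
    (hG : Measurable fun q : (S × T) × T => G q.1.1 q.1.2 q.2)
    (hGt : ∀ z θ θ', G z θ θ' ≠ ∞) (hm : m ≠ 0) (hGm : ∀ z θ θ', m ≤ G z θ θ')
    (hinv : ∀ z θ θ', (G z θ θ')⁻¹ ≤ G z θ' θ)
    (hD : Measurable D) (hD0 : ∀ᵐ θ ∂π, 0 ≤ D θ) (hb : 0 ≤ b)
    (hE : ∀ᵐ θ ∂π, ∀ᵐ θ' ∂π,
      ∫⁻ z, G z θ' θ ∂Q ≤ ENNReal.ofReal (Real.exp (-(a * D θ') + b * D θ))) :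
    ∫⁻ z, (partition π G z)⁻¹ ∂Q ≤ (laplace π D b)⁻¹ * laplace π D a := by
  have hN0 := laplace_ne_zero π hD b
  have hNt := laplace_ne_top π hD0 hb
  have hC := measurable_criterion π hG
  set w : T → ℝ≥0∞ := fun θ' => ENNReal.ofReal (Real.exp (-(b * D θ'))) with hw
  have hwm : Measurable w := by fun_prop
  -- Replacing `1 / G(θ, θ')` by `G(θ', θ)` exchanges the roles of the arguments: the decay `exp(-a
  -- D)` now falls on the integrated variable and produces `L(a)`.
  have hC1 : ∀ᵐ θ ∂π, ∫⁻ z, criterion π G z θ ∂Q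
      ≤ laplace π D a * ENNReal.ofReal (Real.exp (b * D θ)) := by
    filter_upwards [hE] with θ hθ
    have hGθ : Measurable fun q : S × T => (G q.1 θ q.2)⁻¹ :=
      (hG.comp (g := fun q : (S × T) × T => G q.1.1 q.1.2 q.2)
        (f := fun q : S × T => ((q.1, θ), q.2)) (by fun_prop)).inv
    calc ∫⁻ z, criterion π G z θ ∂Q = ∫⁻ θ', ∫⁻ z, (G z θ θ')⁻¹ ∂Q ∂π :=
          lintegral_lintegral_swap hGθ.aemeasurable
      _ ≤ ∫⁻ θ', ENNReal.ofReal (Real.exp (-(a * D θ')))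
            * ENNReal.ofReal (Real.exp (b * D θ)) ∂π := by
          refine lintegral_mono_ae (hθ.mono fun θ' hθ' => ?_)
          rw [← ENNReal.ofReal_mul (by positivity), ← Real.exp_add]
          exact (lintegral_mono fun z => hinv z θ θ').trans hθ'
      _ = _ := lintegral_mul_const _ (by fun_prop)
  calc ∫⁻ z, (partition π G z)⁻¹ ∂Q
      ≤ ∫⁻ z, ((laplace π D b) ^ 2)⁻¹ * ∫⁻ θ, w θ ^ 2 * criterion π G z θ ∂π ∂Q := by
        refine lintegral_mono fun z => ?_
        exact inv_lintegral_inv_le π hwm.aemeasurable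
          (hC.comp (measurable_prodMk_left (x := z))).aemeasurable
          (fun θ => criterion_ne_zero π hG hGt z θ) (fun θ => criterion_ne_top π hm hGm z θ) hN0 hNt
    _ = ((laplace π D b) ^ 2)⁻¹ * ∫⁻ θ, w θ ^ 2 * ∫⁻ z, criterion π G z θ ∂Q ∂π := by
        have hm2 : Measurable fun q : S × T => w q.2 ^ 2 * criterion π G q.1 q.2 :=
          ((hwm.comp measurable_snd).pow_const 2).mul hC
        rw [lintegral_const_mul _ (hm2.lintegral_prod_right'),
          lintegral_lintegral_swap hm2.aemeasurable]
        congr 1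
        refine lintegral_congr fun θ => ?_
        exact lintegral_const_mul (f := fun z => criterion π G z θ) (w θ ^ 2)
          (hC.comp (measurable_prodMk_right (y := θ)))
    _ ≤ ((laplace π D b) ^ 2)⁻¹ * ∫⁻ θ, laplace π D a * w θ ∂π := by
        refine mul_le_mul' le_rfl (lintegral_mono_ae (hC1.mono fun θ hθ => ?_))
        have h1 := ofReal_exp_sq_mul (b * D θ) 0
        rw [zero_add, Real.exp_zero, ENNReal.ofReal_one, one_mul] at h1
        calc w θ ^ 2 * ∫⁻ z, criterion π G z θ ∂Q
            ≤ w θ ^ 2 * (laplace π D a * ENNReal.ofReal (Real.exp (b * D θ))) := by gcongr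
          _ = laplace π D a * (w θ ^ 2 * ENNReal.ofReal (Real.exp (b * D θ))) := by ring
          _ = laplace π D a * w θ := by rw [h1]
    _ = (laplace π D b)⁻¹ * laplace π D a := by
        rw [lintegral_const_mul _ hwm]
        exact inv_sq_mul_mul_self hN0 hNt _

theorem partition_ne_zero (hG : Measurable fun q : (S × T) × T => G q.1.1 q.1.2 q.2)
    (hm : m ≠ 0) (hGm : ∀ z θ θ', m ≤ G z θ θ') (z : S) : partition π G z ≠ 0 :=
  lintegral_ne_zero_of_ne_zero
    ((measurable_criterion π hG).comp (measurable_prodMk_left (x := z))).inv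
    fun θ => ENNReal.inv_ne_zero.2 (criterion_ne_top π hm hGm z θ)

/-- Here `r` stands for the normalizing constant. It cancels in the product of the two terms, which
is at least 1 once `x > t`; two positive numbers with such a product have sum at least 1. -/
theorem one_le_add_of_exp_le {c t x ε ρ₁ ρ₂ r : ℝ} (hc : 0 < c) (hε : 0 < ε) (hρ₁ : 0 < ρ₁)
    (hρ₂ : 0 < ρ₂) (hr : 0 < r) (ht : (2 / ε) ^ 2 * (ρ₁ * ρ₂) ≤ Real.exp (c * t)) (hx : t < x) :
    1 ≤ ε / (2 * ρ₁) * r⁻¹ + ε / (2 * ρ₂) * (r * Real.exp (c * x)) := by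
  have h1 : (2 / ε) ^ 2 * (ρ₁ * ρ₂) ≤ Real.exp (c * x) :=
    ht.trans (Real.exp_le_exp.2 (mul_le_mul_of_nonneg_left hx.le hc.le))
  have h2 : 1 ≤ (ε / (2 * ρ₁) * r⁻¹) * (ε / (2 * ρ₂) * (r * Real.exp (c * x))) := by
    calc (1 : ℝ) = ε ^ 2 / (4 * (ρ₁ * ρ₂)) * ((2 / ε) ^ 2 * (ρ₁ * ρ₂)) := by field_simp; norm_num
      _ ≤ ε ^ 2 / (4 * (ρ₁ * ρ₂)) * Real.exp (c * x) := by gcongr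
      _ = _ := by field_simp; norm_num
  have h3 : 0 < ε / (2 * ρ₁) * r⁻¹ := by positivity
  have h4 : 0 < ε / (2 * ρ₂) * (r * Real.exp (c * x)) := by positivity
  nlinarith [sq_nonneg (ε / (2 * ρ₁) * r⁻¹ - ε / (2 * ρ₂) * (r * Real.exp (c * x)))]

/-- Deviations of `D` under the joint law of the data and of a parameter drawn from the
posterior whose density is inversely proportional to the criterion. -/
theorem compProd_deviation_le
    (hG : Measurable fun q : (S × T) × T => G q.1.1 q.1.2 q.2)
    (hGt : ∀ z θ θ', G z θ θ' ≠ ∞) (hm : m ≠ 0) (hGm : ∀ z θ θ', m ≤ G z θ θ')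
    (hinv : ∀ z θ θ', (G z θ θ')⁻¹ ≤ G z θ' θ) (hZ : ∀ z, partition π G z ≠ ∞)
    (hD : Measurable D) (hD0 : ∀ᵐ θ ∂π, 0 ≤ D θ) (hb : 0 ≤ b)
    {s : Set T} (hs : ∀ᵐ θ ∂π, θ ∈ s)
    (hE : ∀ θ ∈ s, ∀ θ' ∈ s,
      ∫⁻ z, G z θ θ' ∂Q ≤ ENNReal.ofReal (Real.exp (-(a * D θ) + b * D θ')))
    (κ : Kernel S T) [IsMarkovKernel κ]
    (hκ : ∀ z, κ z = π.withDensity fun θ => (partition π G z)⁻¹ * (criterion π G z θ)⁻¹)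
    {c t ε ρ₁ ρ₂ : ℝ} (hc : 0 < c) (hε : 0 < ε) (hρ₁ : 0 < ρ₁) (hρ₂ : 0 < ρ₂)
    (h₁ : laplace π D a ≤ ENNReal.ofReal ρ₁ * laplace π D b)
    (h₂ : laplace π D (a - c) ≤ ENNReal.ofReal ρ₂ * laplace π D b)
    (ht : (2 / ε) ^ 2 * (ρ₁ * ρ₂) ≤ Real.exp (c * t)) :
    (Q ⊗ₘ κ) {ω | t < D ω.2} ≤ ENNReal.ofReal ε := by
  have hN0 := laplace_ne_zero π hD b
  have hNt := laplace_ne_top π hD0 hb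
  have hC := measurable_criterion π hG
  have hP := measurable_partition π hG
  have hP0 : ∀ z, partition π G z ≠ 0 := partition_ne_zero hG hm hGm
  -- These weights make each of the two expectations contribute at most `ε / 2`.
  set s₁ := ENNReal.ofReal (ε / (2 * ρ₁)) with hs₁
  set s₂ := ENNReal.ofReal (ε / (2 * ρ₂)) with hs₂
  have hA : ∫⁻ z, (partition π G z)⁻¹ ∂Q ≤ ENNReal.ofReal ρ₁ := by
    refine (lintegral_inv_partition_le (a := a) hG hGt hm hGm hinv hD hD0 hb
      (hs.mono fun θ hθ => hs.mono fun θ' hθ' => hE θ' hθ' θ hθ)).trans ?_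
    calc (laplace π D b)⁻¹ * laplace π D a
        ≤ (laplace π D b)⁻¹ * (ENNReal.ofReal ρ₁ * laplace π D b) := by gcongr
      _ = ENNReal.ofReal ρ₁ := by
        rw [mul_comm, mul_assoc, ENNReal.mul_inv_cancel hN0 hNt, mul_one]
  have hB : ∫⁻ z, ∫⁻ θ, partition π G z * ENNReal.ofReal (Real.exp (c * D θ)) ∂(κ z) ∂Q
      ≤ ENNReal.ofReal ρ₂ := by
    calc ∫⁻ z, ∫⁻ θ, partition π G z * ENNReal.ofReal (Real.exp (c * D θ)) ∂(κ z) ∂Q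
        = ∫⁻ z, ∫⁻ θ, ENNReal.ofReal (Real.exp (c * D θ)) * (criterion π G z θ)⁻¹ ∂π ∂Q := by
          refine lintegral_congr fun z => ?_
          rw [hκ z, lintegral_withDensity_eq_lintegral_mul
            (f := fun θ => (partition π G z)⁻¹ * (criterion π G z θ)⁻¹) _
            (((hC.comp (measurable_prodMk_left (x := z))).inv).const_mul _) (by fun_prop)]
          refine lintegral_congr fun θ => ?_
          simp only [Pi.mul_apply]
          calc (partition π G z)⁻¹ * (criterion π G z θ)⁻¹ *
                (partition π G z * ENNReal.ofReal (Real.exp (c * D θ)))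
              = ((partition π G z)⁻¹ * partition π G z) *
                (ENNReal.ofReal (Real.exp (c * D θ)) * (criterion π G z θ)⁻¹) := by ring
            _ = _ := by rw [ENNReal.inv_mul_cancel (hP0 z) (hZ z), one_mul]
      _ = ∫⁻ θ, ENNReal.ofReal (Real.exp (c * D θ)) * ∫⁻ z, (criterion π G z θ)⁻¹ ∂Q ∂π := by
          have hm2 : Measurable fun q : S × T =>
              ENNReal.ofReal (Real.exp (c * D q.2)) * (criterion π G q.1 q.2)⁻¹ :=
            Measurable.mul (by fun_prop) hC.inv
          rw [lintegral_lintegral_swap hm2.aemeasurable]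
          refine lintegral_congr fun θ => ?_
          exact lintegral_const_mul (f := fun z => (criterion π G z θ)⁻¹) _
            (hC.comp (measurable_prodMk_right (y := θ))).inv
      _ ≤ ∫⁻ θ, (laplace π D b)⁻¹ * ENNReal.ofReal (Real.exp (-((a - c) * D θ))) ∂π := by
          refine lintegral_mono_ae ((lintegral_inv_criterion_le hG hGt hm hGm hD hD0 hb
            (hs.mono fun θ hθ => hs.mono fun θ' hθ' => hE θ hθ θ' hθ')).mono fun θ hθ => ?_)
          calc _ ≤ ENNReal.ofReal (Real.exp (c * D θ)) *
                ((laplace π D b)⁻¹ * ENNReal.ofReal (Real.exp (-(a * D θ)))) := by gcongr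
            _ = (laplace π D b)⁻¹ * (ENNReal.ofReal (Real.exp (c * D θ)) *
                ENNReal.ofReal (Real.exp (-(a * D θ)))) := by ring
            _ = _ := by
              rw [← ENNReal.ofReal_mul (by positivity), ← Real.exp_add]
              congr 4
              ring
      _ = (laplace π D b)⁻¹ * laplace π D (a - c) := lintegral_const_mul _ (by fun_prop)
      _ ≤ (laplace π D b)⁻¹ * (ENNReal.ofReal ρ₂ * laplace π D b) := by gcongr
      _ = ENNReal.ofReal ρ₂ := by
        rw [mul_comm, mul_assoc, ENNReal.mul_inv_cancel hN0 hNt, mul_one]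
  have hm1 : Measurable fun ω : S × T => s₁ * (partition π G ω.1)⁻¹ :=
    ((hP.comp measurable_fst).inv).const_mul _
  have hm2 : Measurable fun ω : S × T =>
      partition π G ω.1 * ENNReal.ofReal (Real.exp (c * D ω.2)) :=
    Measurable.mul (hP.comp measurable_fst) (by fun_prop)
  have hbad : MeasurableSet {ω : S × T | t < D ω.2} :=
    measurableSet_lt measurable_const (hD.comp measurable_snd)
  calc (Q ⊗ₘ κ) {ω | t < D ω.2}
      = ∫⁻ ω, {ω : S × T | t < D ω.2}.indicator 1 ω ∂(Q ⊗ₘ κ) := (lintegral_indicator_one hbad).symm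
    -- Markov's inequality for both variables at once: the indicator of the bad event is dominated
    -- by a sum whose expectation is known.
    _ ≤ ∫⁻ ω, (s₁ * (partition π G ω.1)⁻¹ +
          s₂ * (partition π G ω.1 * ENNReal.ofReal (Real.exp (c * D ω.2)))) ∂(Q ⊗ₘ κ) := by
        refine lintegral_mono fun ω => ?_
        rw [Set.indicator_apply]
        split_ifs with hω
        swap
        · exact zero_le
        have hr : 0 < (partition π G ω.1).toReal := ENNReal.toReal_pos (hP0 ω.1) (hZ ω.1)
        rw [← ENNReal.ofReal_toReal (hZ ω.1), ← ENNReal.ofReal_inv_of_pos hr, hs₁, hs₂,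
          ← ENNReal.ofReal_mul (by positivity), ← ENNReal.ofReal_mul (by positivity),
          ← ENNReal.ofReal_mul (by positivity), ← ENNReal.ofReal_add (by positivity)
          (by positivity), Pi.one_apply, ← ENNReal.ofReal_one]
        exact ENNReal.ofReal_le_ofReal (one_le_add_of_exp_le hc hε hρ₁ hρ₂ hr ht hω)
    _ = s₁ * ∫⁻ z, (partition π G z)⁻¹ ∂Q + s₂ *
          ∫⁻ z, ∫⁻ θ, partition π G z * ENNReal.ofReal (Real.exp (c * D θ)) ∂(κ z) ∂Q := by
        rw [lintegral_add_left hm1, Measure.lintegral_compProd hm1, lintegral_const_mul _ hm2,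
          Measure.lintegral_compProd hm2]
        simp only [lintegral_const, measure_univ, mul_one]
        rw [lintegral_const_mul (f := fun z => (partition π G z)⁻¹) _ hP.inv]
    _ ≤ s₁ * ENNReal.ofReal ρ₁ + s₂ * ENNReal.ofReal ρ₂ := by gcongr
    _ = ENNReal.ofReal ε := by
        rw [hs₁, hs₂, ← ENNReal.ofReal_mul (by positivity), ← ENNReal.ofReal_mul (by positivity),
          ← ENNReal.ofReal_add (by positivity) (by positivity)]
        congr 1
        field_simp
        norm_num

end Deviation

end PacBayesLS

/-! ### The uniform distribution on a convex set of any dimension -/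

namespace PacBayesLS

open MeasureTheory ProbabilityTheory Measure
open scoped ENNReal NNReal

/-- The affine hull is a bi-Lipschitz image of `ℝ^k`. The preimage of `Θ` there is bounded, convex
and affinely spanning, so it has nonempty interior and its volume is positive and finite; Lipschitz
bounds in both directions transfer this to `Θ`. -/
theorem hausdorffMeasure_convex_pos_lt_top {d : ℕ} {Θ : Set (Fin d → ℝ)} (hΘ : Convex ℝ Θ)
    (hb : Bornology.IsBounded Θ) (hne : Θ.Nonempty) :
    μH[(Module.finrank ℝ (vectorSpan ℝ Θ) : ℝ)] Θ ≠ 0 ∧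
      μH[(Module.finrank ℝ (vectorSpan ℝ Θ) : ℝ)] Θ ≠ ∞ := by
  obtain ⟨p, hp⟩ := hne
  set V := vectorSpan ℝ Θ with hV
  set k := Module.finrank ℝ V with hk
  have e : (Fin k → ℝ) ≃L[ℝ] V := ContinuousLinearEquiv.ofFinrankEq (by simp [hk])
  let L : (Fin k → ℝ) →ₗ[ℝ] (Fin d → ℝ) := V.subtype ∘ₗ (e : (Fin k → ℝ) →ₗ[ℝ] V)
  let A : (Fin k → ℝ) →ᵃ[ℝ] (Fin d → ℝ) := L.toAffineMap + AffineMap.const ℝ _ p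
  have hA : ∀ u, A u = (e u : Fin d → ℝ) + p := fun u => rfl
  have hAe : A = IsometryEquiv.addRight p ∘ Subtype.val ∘ e := funext hA
  obtain ⟨K, hK⟩ : ∃ K : ℝ≥0, LipschitzWith K A := by
    rw [hAe]
    exact ⟨_, (IsometryEquiv.addRight p).isometry.lipschitz.comp
      (isometry_subtype_coe.lipschitz.comp e.lipschitz)⟩
  obtain ⟨K', hK'⟩ : ∃ K' : ℝ≥0, AntilipschitzWith K' A := by
    rw [hAe]
    exact ⟨_, (IsometryEquiv.addRight p).isometry.antilipschitz.comp
      (isometry_subtype_coe.antilipschitz.comp e.antilipschitz)⟩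
  set S := A ⁻¹' Θ with hS
  have hAS : A '' S = Θ := by
    refine Set.image_preimage_eq_of_subset fun θ hθ => ?_
    have h1 : θ - p ∈ V := vsub_mem_vectorSpan ℝ hθ hp
    refine ⟨e.symm ⟨θ - p, h1⟩, ?_⟩
    rw [hA]
    simp
  have hSc : Convex ℝ S := hΘ.affine_preimage A
  have hSb : Bornology.IsBounded S := by
    have := hK'.isBounded_preimage hb
    exact this
  have hLinj : Function.Injective L := V.injective_subtype.comp e.injective
  have hSspan : affineSpan ℝ S = ⊤ := by
    have h0 : S.Nonempty := by
      rw [← hAS] at hp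
      exact Set.image_nonempty.1 ⟨_, hp⟩
    rw [AffineSubspace.affineSpan_eq_top_iff_vectorSpan_eq_top_of_nonempty _ _ _ h0]
    have h1 : (vectorSpan ℝ S).map A.linear = V := by
      rw [AffineMap.map_vectorSpan, hAS]
    have hAl : A.linear = L := by simp [A]
    rw [hAl] at h1
    refine Submodule.map_injective_of_injective hLinj ?_
    rw [h1, Submodule.map_top]
    simp [L, LinearMap.range_comp]
  have hint : (interior S).Nonempty := hSc.interior_nonempty_iff_affineSpan_eq_top.2 hSspan
  have hvol : (μH[(k : ℝ)] : Measure (Fin k → ℝ)) = volume := by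
    have := hausdorffMeasure_pi_real (ι := Fin k)
    rwa [Fintype.card_fin] at this
  constructor
  · intro h0
    have h1 := hK'.le_hausdorffMeasure_image (d := (k : ℝ)) (by positivity) S
    rw [hAS, h0, mul_zero, hvol] at h1
    exact (measure_pos_of_nonempty_interior volume hint).ne' (le_antisymm h1 zero_le)
  · have h1 := hK.hausdorffMeasure_image_le (d := (k : ℝ)) (by positivity) S
    rw [hAS, hvol] at h1
    exact ne_top_of_le_ne_top (ENNReal.mul_ne_top (by simp) hSb.measure_lt_top.ne) h1

theorem isProbabilityMeasure_uniformDistribution {d : ℕ} {Θ : Set (Fin d → ℝ)}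
    (hΘ : Convex ℝ Θ) (hb : Bornology.IsBounded Θ) (hne : Θ.Nonempty) :
    IsProbabilityMeasure (uniformDistribution Θ) :=
  have h := hausdorffMeasure_convex_pos_lt_top hΘ hb hne
  cond_isProbabilityMeasure_of_finite h.1 h.2

/-- Comparison of the integrals of `f` and of `g` under the uniform distribution, when `f` is
dominated by the composition of `g` with a contraction towards a point of the convex set. -/
theorem lintegral_uniformDistribution_le {d : ℕ} {Θ : Set (Fin d → ℝ)} (hc : IsClosed Θ)
    (hΘ : Convex ℝ Θ) {p : Fin d → ℝ} (hp : p ∈ Θ)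
    {c : ℝ} (hc0 : 0 < c) (hc1 : c ≤ 1) {f g : (Fin d → ℝ) → ℝ≥0∞} (hg : Measurable g)
    (hfg : ∀ θ ∈ Θ, f θ ≤ g (AffineMap.homothety p c θ)) :
    ∫⁻ θ, f θ ∂(uniformDistribution Θ) ≤
      ENNReal.ofReal ((c ^ d)⁻¹) * ∫⁻ θ, g θ ∂(uniformDistribution Θ) := by
  set k := Module.finrank ℝ (vectorSpan ℝ Θ) with hk
  have hkd : k ≤ d := by simpa using Submodule.finrank_le (vectorSpan ℝ Θ)
  set μ : Measure (Fin d → ℝ) := μH[(k : ℝ)] with hμ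
  have hu : uniformDistribution Θ = (μ Θ)⁻¹ • μ.restrict Θ := rfl
  have hme : Measurable (AffineMap.homothety p c) :=
    (AffineMap.homothety_continuous p c).measurable
  have hsub : Θ ⊆ AffineMap.homothety p c ⁻¹' Θ := by
    intro θ hθ
    rw [Set.mem_preimage, AffineMap.homothety_eq_lineMap]
    exact hΘ.lineMap_mem hp hθ ⟨hc0.le, hc1⟩
  -- The Jacobian is `c ^ (-k)` with `k` the dimension of the affine hull; since `c ≤ 1` and `k ≤
  -- d`, it is at most `c ^ (-d)`.
  have hmap : μ.map (AffineMap.homothety p c) = ‖c‖₊⁻¹ ^ (k : ℝ) • μ :=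
    map_homothety_hausdorffMeasure (by positivity) p hc0.ne'
  have hcst : ((‖c‖₊⁻¹ ^ (k : ℝ) : ℝ≥0) : ℝ≥0∞) ≤ ENNReal.ofReal ((c ^ d)⁻¹) := by
    rw [← ENNReal.ofReal_coe_nnreal]
    refine ENNReal.ofReal_le_ofReal ?_
    rw [NNReal.rpow_natCast]
    push_cast
    rw [Real.norm_of_nonneg hc0.le, inv_pow]
    exact inv_anti₀ (by positivity) (pow_le_pow_of_le_one hc0.le hc1 hkd)
  have key : ∫⁻ θ in Θ, f θ ∂μ ≤ ENNReal.ofReal ((c ^ d)⁻¹) * ∫⁻ θ in Θ, g θ ∂μ := by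
    calc ∫⁻ θ in Θ, f θ ∂μ ≤ ∫⁻ θ in Θ, g (AffineMap.homothety p c θ) ∂μ :=
          setLIntegral_mono (hg.comp hme) hfg
      _ ≤ ∫⁻ θ in AffineMap.homothety p c ⁻¹' Θ, g (AffineMap.homothety p c θ) ∂μ :=
          lintegral_mono_set hsub
      _ = ∫⁻ θ in Θ, g θ ∂(μ.map (AffineMap.homothety p c)) :=
          (setLIntegral_map hc.measurableSet hg hme).symm
      _ = ((‖c‖₊⁻¹ ^ (k : ℝ) : ℝ≥0) : ℝ≥0∞) * ∫⁻ θ in Θ, g θ ∂μ := by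
          rw [hmap, Measure.restrict_smul, lintegral_smul_measure]
          rfl
      _ ≤ _ := by gcongr
  rw [hu, lintegral_smul_measure, lintegral_smul_measure, smul_eq_mul, smul_eq_mul]
  calc _ ≤ (μ Θ)⁻¹ * (ENNReal.ofReal ((c ^ d)⁻¹) * ∫⁻ θ in Θ, g θ ∂μ) := by gcongr
    _ = _ := by ring

end PacBayesLS

namespace PacBayesLS

open MeasureTheory ProbabilityTheory
open scoped ENNReal NNReal

/-! ### Algebra of loss differences and of the truncated factors -/

section Algebra

variable {𝒳 : Type*} {d : ℕ} (φ : Fin d → 𝒳 → ℝ)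

theorem linComb_sub (θ θ' : Fin d → ℝ) (x : 𝒳) :
    linComb φ (θ - θ') x = linComb φ θ x - linComb φ θ' x := by
  simp [linComb, sub_mul, Finset.sum_sub_distrib]

theorem linComb_smul (c : ℝ) (θ : Fin d → ℝ) (x : 𝒳) :
    linComb φ (c • θ) x = c * linComb φ θ x := by
  simp [linComb, Finset.mul_sum, mul_assoc]

theorem measurable_linComb [MeasurableSpace 𝒳] {φ : Fin d → 𝒳 → ℝ} (hφ : ∀ j, Measurable (φ j))
    (θ : Fin d → ℝ) : Measurable (linComb φ θ) :=
  Finset.measurable_sum _ fun j _ => (hφ j).const_mul _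

theorem lossDiff_eq (lam : ℝ) (z : 𝒳 × ℝ) (θ θ₀ : Fin d → ℝ) :
    lossDiff lam z (linComb φ θ) (linComb φ θ₀) = -lam * (linComb φ (θ - θ₀) z.1 *
      (2 * (z.2 - linComb φ θ₀ z.1) - linComb φ (θ - θ₀) z.1)) := by
  rw [lossDiff, linComb_sub]
  ring

/-- The factor `1 - W + W² / 2` of the empirical criterion. -/
noncomputable def truncation (lam : ℝ) (φ : Fin d → 𝒳 → ℝ) (z : 𝒳 × ℝ) (θ θ' : Fin d → ℝ) : ℝ :=
  1 - lossDiff lam z (linComb φ θ) (linComb φ θ')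
    + (1 / 2) * lossDiff lam z (linComb φ θ) (linComb φ θ') ^ 2

theorem lossDiff_sub (lam : ℝ) (z : 𝒳 × ℝ) (f f' f₀ : 𝒳 → ℝ) :
    lossDiff lam z f f' = lossDiff lam z f f₀ - lossDiff lam z f' f₀ := by
  unfold lossDiff
  ring

/-- `1 - W + W² / 2 = ((W - 1)² + 1) / 2`. -/
theorem half_le_truncation (lam : ℝ) (z : 𝒳 × ℝ) (θ θ' : Fin d → ℝ) :
    1 / 2 ≤ truncation lam φ z θ θ' := by
  unfold truncation
  nlinarith [sq_nonneg (lossDiff lam z (linComb φ θ) (linComb φ θ') - 1)]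

/-- Exchanging the arguments changes the sign of `W`, and `(1 - W + W² / 2) (1 + W + W² / 2) = 1 +
W⁴ / 4 ≥ 1`. -/
theorem inv_truncation_le (lam : ℝ) (z : 𝒳 × ℝ) (θ θ' : Fin d → ℝ) :
    (truncation lam φ z θ θ')⁻¹ ≤ truncation lam φ z θ' θ := by
  have h0 : 0 < truncation lam φ z θ θ' := by linarith [half_le_truncation φ lam z θ θ']
  rw [inv_le_iff_one_le_mul₀ h0]
  have e : lossDiff lam z (linComb φ θ') (linComb φ θ)
      = -lossDiff lam z (linComb φ θ) (linComb φ θ') := by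
    unfold lossDiff
    ring
  unfold truncation
  rw [e]
  generalize lossDiff lam z (linComb φ θ) (linComb φ θ') = W
  nlinarith [sq_nonneg (W ^ 2)]

end Algebra

/-! ### Second moments under the conditional variance bound -/

section Moments

variable {𝒳 : Type*} [MeasurableSpace 𝒳] {P : Measure (𝒳 × ℝ)}
  {H σ : ℝ} {h : 𝒳 → ℝ} {ζ : 𝒳 × ℝ → ℝ}

theorem integrable_sq_mul_sq (hh : Measurable h) (hH : ∀ x, |h x| ≤ H) (hζ : MemLp ζ 2 P) :
    Integrable (fun z => h z.1 ^ 2 * ζ z ^ 2) P := by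
  refine hζ.integrable_sq.bdd_mul (c := H ^ 2) ?_ (Filter.Eventually.of_forall fun z => ?_)
  · exact ((hh.comp measurable_fst).pow_const 2).aestronglyMeasurable
  · rw [Real.norm_eq_abs, abs_pow]
    exact pow_le_pow_left₀ (abs_nonneg _) (hH _) 2

variable [IsProbabilityMeasure P]

theorem integrable_sq_of_bound (hh : Measurable h) (hH : ∀ x, |h x| ≤ H) :
    Integrable (fun z : 𝒳 × ℝ => h z.1 ^ 2) P := by
  have := integrable_sq_mul_sq hh hH (memLp_const (1 : ℝ) : MemLp (fun _ => (1 : ℝ)) 2 P)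
  simpa using this

/-- A bound on a conditional second moment can be used under weights depending on the
conditioning variable. -/
theorem integral_sq_mul_sq_le (hh : Measurable h) (hH : ∀ x, |h x| ≤ H) (hζ : MemLp ζ 2 P)
    (hcond : P[fun z => ζ z ^ 2 | MeasurableSpace.comap (Prod.fst : 𝒳 × ℝ → 𝒳) inferInstance]
      ≤ᵐ[P] fun _ => σ ^ 2) :
    ∫ z, h z.1 ^ 2 * ζ z ^ 2 ∂P ≤ σ ^ 2 * ∫ z, h z.1 ^ 2 ∂P := by
  set m : MeasurableSpace (𝒳 × ℝ) :=
    MeasurableSpace.comap (Prod.fst : 𝒳 × ℝ → 𝒳) inferInstance with hm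
  have hle : m ≤ Prod.instMeasurableSpace := measurable_fst.comap_le
  have hsm : StronglyMeasurable[m] fun z : 𝒳 × ℝ => h z.1 ^ 2 :=
    ((hh.comp (comap_measurable (Prod.fst : 𝒳 × ℝ → 𝒳))).pow_const 2).stronglyMeasurable
  have hi := integrable_sq_mul_sq hh hH hζ
  have hpull : P[fun z => h z.1 ^ 2 * ζ z ^ 2 | m]
      =ᵐ[P] fun z => h z.1 ^ 2 * P[fun z => ζ z ^ 2 | m] z :=
    condExp_mul_of_stronglyMeasurable_left hsm hi hζ.integrable_sq
  rw [← integral_condExp hle, ← integral_const_mul]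
  refine integral_mono_ae integrable_condExp ((integrable_sq_of_bound hh hH).const_mul _) ?_
  filter_upwards [hpull, hcond] with z h1 h2
  rw [h1, mul_comm]
  exact mul_le_mul_of_nonneg_right h2 (sq_nonneg _)

/-- Expand `(2ζ - h)²` and bound the cross term by `4 H |ζ| ≤ 2 H (ζ² / σ + σ)`. This choice of
weights is sharp at `|ζ| = σ`, so replacing `ζ²` by `σ²` under the conditional expectation gives the
perfect square `4σ² + 4Hσ + H²`. -/
theorem integral_sq_mul_two_mul_sub_sq_le (hσ : 0 < σ) (hh : Measurable h) (hH : ∀ x, |h x| ≤ H)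
    (hζ : MemLp ζ 2 P)
    (hcond : P[fun z => ζ z ^ 2 | MeasurableSpace.comap (Prod.fst : 𝒳 × ℝ → 𝒳) inferInstance]
      ≤ᵐ[P] fun _ => σ ^ 2) :
    ∫ z, (h z.1 * (2 * ζ z - h z.1)) ^ 2 ∂P ≤ (2 * σ + H) ^ 2 * ∫ z, h z.1 ^ 2 ∂P := by
  obtain ⟨z₀⟩ := nonempty_of_isProbabilityMeasure P
  have hH0 : 0 ≤ H := (abs_nonneg _).trans (hH z₀.1)
  have hi := integrable_sq_mul_sq hh hH hζ
  have hi2 := integrable_sq_of_bound (P := P) hh hH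
  have hle := integral_sq_mul_sq_le hh hH hζ hcond
  calc ∫ z, (h z.1 * (2 * ζ z - h z.1)) ^ 2 ∂P
      ≤ ∫ z, ((4 + 2 * H / σ) * (h z.1 ^ 2 * ζ z ^ 2) + (2 * H * σ + H ^ 2) * h z.1 ^ 2) ∂P := by
        refine integral_mono_of_nonneg (Filter.Eventually.of_forall fun z => sq_nonneg _)
          ((hi.const_mul _).add (hi2.const_mul _)) (Filter.Eventually.of_forall fun z => ?_)
        have h1 : -(4 * (h z.1 * ζ z)) ≤ 2 * H / σ * ζ z ^ 2 + 2 * H * σ := by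
          have h2 : -(h z.1 * ζ z) ≤ H * |ζ z| := by
            calc -(h z.1 * ζ z) ≤ |h z.1 * ζ z| := neg_le_abs _
              _ = |h z.1| * |ζ z| := abs_mul _ _
              _ ≤ H * |ζ z| := by gcongr; exact hH _
          have h3 : 2 * |ζ z| ≤ ζ z ^ 2 / σ + σ := by
            rw [← sq_abs (ζ z)]
            have : 0 ≤ (|ζ z| - σ) ^ 2 / σ := by positivity
            have e : (|ζ z| - σ) ^ 2 / σ = |ζ z| ^ 2 / σ + σ - 2 * |ζ z| := by field_simp; ring
            linarith
          have h4 := mul_le_mul_of_nonneg_left h3 hH0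
          calc -(4 * (h z.1 * ζ z)) ≤ 2 * (H * (2 * |ζ z|)) := by linarith
            _ ≤ 2 * (H * (ζ z ^ 2 / σ + σ)) := by linarith
            _ = _ := by ring
        have h5 : h z.1 ^ 2 ≤ H ^ 2 := by
          rw [← sq_abs]
          exact pow_le_pow_left₀ (abs_nonneg _) (hH _) 2
        have h6 : (2 * ζ z - h z.1) ^ 2 ≤ (4 + 2 * H / σ) * ζ z ^ 2 + (2 * H * σ + H ^ 2) := by
          nlinarith
        calc (h z.1 * (2 * ζ z - h z.1)) ^ 2 = h z.1 ^ 2 * (2 * ζ z - h z.1) ^ 2 := by ring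
          _ ≤ h z.1 ^ 2 * ((4 + 2 * H / σ) * ζ z ^ 2 + (2 * H * σ + H ^ 2)) := by gcongr
          _ = _ := by ring
    _ = (4 + 2 * H / σ) * ∫ z, h z.1 ^ 2 * ζ z ^ 2 ∂P
          + (2 * H * σ + H ^ 2) * ∫ z, h z.1 ^ 2 ∂P := by
        rw [integral_add (hi.const_mul _) (hi2.const_mul _), integral_const_mul, integral_const_mul]
    _ ≤ (4 + 2 * H / σ) * (σ ^ 2 * ∫ z, h z.1 ^ 2 ∂P)
          + (2 * H * σ + H ^ 2) * ∫ z, h z.1 ^ 2 ∂P := by gcongr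
    _ = _ := by field_simp; ring

/-- Boundedness of `h` makes loss differences square integrable although the losses themselves need
not be: only one factor `ζ` remains. -/
theorem memLp_mul_two_mul_sub (hh : Measurable h) (hH : ∀ x, |h x| ≤ H) (hζ : MemLp ζ 2 P) :
    MemLp (fun z => h z.1 * (2 * ζ z - h z.1)) 2 P := by
  have h1 : MemLp (fun z : 𝒳 × ℝ => h z.1) ∞ P :=
    memLp_top_of_bound (hh.comp measurable_fst).aestronglyMeasurable H
      (Filter.Eventually.of_forall fun z => hH z.1)
  have h2 : MemLp (fun z => 2 * ζ z - h z.1) 2 P :=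
    (hζ.const_mul 2).sub (h1.mono_exponent le_top)
  exact h2.mul h1

end Moments

/-! ### Geometry of the excess risk -/

section Risk

variable {𝒳 : Type*} [MeasurableSpace 𝒳] {P : Measure (𝒳 × ℝ)}
  {d : ℕ} {φ : Fin d → 𝒳 → ℝ}

theorem memLp_linComb (hφ2 : ∀ j, MemLp (fun z : 𝒳 × ℝ => φ j z.1) 2 P) (θ : Fin d → ℝ) :
    MemLp (fun z : 𝒳 × ℝ => linComb φ θ z.1) 2 P :=
  memLp_finsetSum _ fun j _ => (hφ2 j).const_mul (θ j)

theorem memLp_residual (hY : MemLp (fun z : 𝒳 × ℝ => z.2) 2 P)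
    (hφ2 : ∀ j, MemLp (fun z : 𝒳 × ℝ => φ j z.1) 2 P) (θ : Fin d → ℝ) :
    MemLp (fun z : 𝒳 × ℝ => z.2 - linComb φ θ z.1) 2 P :=
  hY.sub (memLp_linComb hφ2 θ)

/-- The excess risk of `f_θ` with respect to `f_θ₀`. -/
noncomputable def excessRisk (P : Measure (𝒳 × ℝ)) (φ : Fin d → 𝒳 → ℝ) (θ₀ θ : Fin d → ℝ) : ℝ :=
  risk P (linComb φ θ) - risk P (linComb φ θ₀)

theorem measurable_excessRisk [SFinite P] (hφ : ∀ j, Measurable (φ j)) (θ₀ : Fin d → ℝ) :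
    Measurable (excessRisk P φ θ₀) := by
  refine Measurable.sub_const ?_ _
  have h1 : Measurable fun q : (Fin d → ℝ) × (𝒳 × ℝ) => (q.2.2 - linComb φ q.1 q.2.1) ^ 2 := by
    refine (measurable_snd.snd.sub ?_).pow_const 2
    refine Finset.measurable_sum _ fun j _ => ?_
    exact ((measurable_pi_apply j).comp measurable_fst).mul ((hφ j).comp measurable_snd.fst)
  exact (h1.stronglyMeasurable.integral_prod_right (ν := P)).measurable

variable {θ₀ : Fin d → ℝ}

theorem excessRisk_eq (hY : MemLp (fun z : 𝒳 × ℝ => z.2) 2 P)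
    (hφ2 : ∀ j, MemLp (fun z : 𝒳 × ℝ => φ j z.1) 2 P) (θ : Fin d → ℝ) :
    excessRisk P φ θ₀ θ = ∫ z, linComb φ (θ - θ₀) z.1 ^ 2 ∂P
      - 2 * ∫ z, linComb φ (θ - θ₀) z.1 * (z.2 - linComb φ θ₀ z.1) ∂P := by
  have hh := memLp_linComb hφ2 (θ - θ₀)
  have hζ := memLp_residual hY hφ2 θ₀
  have hf := memLp_residual hY hφ2 θ
  have hhζ : Integrable (fun z : 𝒳 × ℝ => linComb φ (θ - θ₀) z.1 * (z.2 - linComb φ θ₀ z.1)) P :=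
    hh.integrable_mul hζ
  unfold excessRisk risk
  rw [← integral_const_mul, ← integral_sub hh.integrable_sq (hhζ.const_mul 2),
    ← integral_sub hf.integrable_sq hζ.integrable_sq]
  refine integral_congr_ae (Filter.Eventually.of_forall fun z => ?_)
  simp only [linComb_sub]
  ring

theorem excessRisk_homothety (hY : MemLp (fun z : 𝒳 × ℝ => z.2) 2 P)
    (hφ2 : ∀ j, MemLp (fun z : 𝒳 × ℝ => φ j z.1) 2 P) (θ : Fin d → ℝ) (c : ℝ) :
    excessRisk P φ θ₀ (AffineMap.homothety θ₀ c θ)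
      = c ^ 2 * ∫ z, linComb φ (θ - θ₀) z.1 ^ 2 ∂P
      - c * (2 * ∫ z, linComb φ (θ - θ₀) z.1 * (z.2 - linComb φ θ₀ z.1) ∂P) := by
  have e : AffineMap.homothety θ₀ c θ - θ₀ = c • (θ - θ₀) := by
    simp [AffineMap.homothety_apply]
  rw [excessRisk_eq hY hφ2, e]
  simp only [linComb_smul, mul_pow, mul_assoc]
  rw [integral_const_mul, integral_const_mul]
  ring

/-- First-order optimality condition for a minimizer of the risk on a convex set. -/
theorem integral_sq_le_excessRisk (hY : MemLp (fun z : 𝒳 × ℝ => z.2) 2 P)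
    (hφ2 : ∀ j, MemLp (fun z : 𝒳 × ℝ => φ j z.1) 2 P) {Θ : Set (Fin d → ℝ)} (hΘ : Convex ℝ Θ)
    (hθ₀ : θ₀ ∈ Θ) (hmin : ∀ θ ∈ Θ, risk P (linComb φ θ₀) ≤ risk P (linComb φ θ))
    {θ : Fin d → ℝ} (hθ : θ ∈ Θ) :
    ∫ z, linComb φ (θ - θ₀) z.1 ^ 2 ∂P ≤ excessRisk P φ θ₀ θ := by
  have hA : 0 ≤ ∫ z, linComb φ (θ - θ₀) z.1 ^ 2 ∂P := integral_nonneg fun z => sq_nonneg _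
  have hc : ∀ c : ℝ, 0 < c → c ≤ 1 → 0 ≤ excessRisk P φ θ₀ (AffineMap.homothety θ₀ c θ) := by
    intro c hc0 hc1
    refine sub_nonneg.2 (hmin _ ?_)
    rw [AffineMap.homothety_eq_lineMap]
    exact hΘ.lineMap_mem hθ₀ hθ ⟨hc0.le, hc1⟩
  simp only [excessRisk_homothety hY hφ2] at hc
  rw [excessRisk_eq hY hφ2]
  set A := ∫ z, linComb φ (θ - θ₀) z.1 ^ 2 ∂P
  set B := ∫ z, linComb φ (θ - θ₀) z.1 * (z.2 - linComb φ θ₀ z.1) ∂P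
  suffices B ≤ 0 by linarith
  by_contra! hB
  have hs : 0 < A + B := by linarith
  -- Minimality along the segment gives `c A ≥ 2 B`. For `c = B / (A + B)` one has `c A ≤ B`,
  -- contradicting `B > 0`.
  have hc0 : 0 < B / (A + B) := by positivity
  have h1 := hc (B / (A + B)) hc0 ((div_le_one hs).2 (by linarith))
  have h2 : B / (A + B) * A ≤ B := by
    rw [div_mul_eq_mul_div, div_le_iff₀ hs]
    nlinarith
  nlinarith

/-- Convexity along the ray: the two sides differ by `c (1 - c) ∫ h²`, where `h = f_θ - f_θ₀`. -/
theorem excessRisk_homothety_le (hY : MemLp (fun z : 𝒳 × ℝ => z.2) 2 P)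
    (hφ2 : ∀ j, MemLp (fun z : 𝒳 × ℝ => φ j z.1) 2 P) (θ : Fin d → ℝ) {c : ℝ} (hc0 : 0 ≤ c)
    (hc1 : c ≤ 1) :
    excessRisk P φ θ₀ (AffineMap.homothety θ₀ c θ) ≤ c * excessRisk P φ θ₀ θ := by
  have hA : 0 ≤ ∫ z, linComb φ (θ - θ₀) z.1 ^ 2 ∂P := integral_nonneg fun z => sq_nonneg _
  rw [excessRisk_homothety hY hφ2, excessRisk_eq hY hφ2]
  nlinarith [mul_nonneg (mul_nonneg hc0 (sub_nonneg.2 hc1)) hA]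

/-- Around a minimizer of the risk on the whole linear span, the excess risk is quadratic. -/
theorem excessRisk_homothety_eq (hY : MemLp (fun z : 𝒳 × ℝ => z.2) 2 P)
    (hφ2 : ∀ j, MemLp (fun z : 𝒳 × ℝ => φ j z.1) 2 P)
    (hmin : ∀ θ, risk P (linComb φ θ₀) ≤ risk P (linComb φ θ)) (θ : Fin d → ℝ) (c : ℝ) :
    excessRisk P φ θ₀ (AffineMap.homothety θ₀ c θ) = c ^ 2 * excessRisk P φ θ₀ θ := by
  have h0 : ∀ θ, 2 * ∫ z, linComb φ (θ - θ₀) z.1 * (z.2 - linComb φ θ₀ z.1) ∂P ≤ 0 := by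
    intro θ
    have h1 := integral_sq_le_excessRisk hY hφ2 convex_univ (Set.mem_univ θ₀)
      (fun θ _ => hmin θ) (Set.mem_univ θ)
    rw [excessRisk_eq hY hφ2] at h1
    linarith
  have h1 := h0 θ
  have h2 := h0 (θ₀ - (θ - θ₀))
  have e : θ₀ - (θ - θ₀) - θ₀ = (-1 : ℝ) • (θ - θ₀) := by simp
  rw [e] at h2
  simp only [linComb_smul, mul_assoc] at h2
  rw [integral_const_mul] at h2
  have h3 : 2 * ∫ z, linComb φ (θ - θ₀) z.1 * (z.2 - linComb φ θ₀ z.1) ∂P = 0 := by linarith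
  rw [excessRisk_homothety hY hφ2, excessRisk_eq hY hφ2, h3]
  ring

theorem integral_lossDiff (hY : MemLp (fun z : 𝒳 × ℝ => z.2) 2 P)
    (hφ2 : ∀ j, MemLp (fun z : 𝒳 × ℝ => φ j z.1) 2 P) (lam : ℝ) (θ : Fin d → ℝ) :
    ∫ z, lossDiff lam z (linComb φ θ) (linComb φ θ₀) ∂P = lam * excessRisk P φ θ₀ θ := by
  simp only [lossDiff]
  rw [integral_const_mul, integral_sub (memLp_residual hY hφ2 θ).integrable_sq
    (memLp_residual hY hφ2 θ₀).integrable_sq]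
  rfl

end Risk

/-! ### Exponential moment bound for one observation -/

section LossDiff

variable {𝒳 : Type*} [MeasurableSpace 𝒳] {P : Measure (𝒳 × ℝ)} [IsProbabilityMeasure P]
  {d : ℕ} {φ : Fin d → 𝒳 → ℝ} {θ₀ : Fin d → ℝ} {Θ : Set (Fin d → ℝ)} {H σ lam : ℝ}

theorem memLp_lossDiff (hY : MemLp (fun z : 𝒳 × ℝ => z.2) 2 P) (hφ : ∀ j, Measurable (φ j))
    (hφ2 : ∀ j, MemLp (fun z : 𝒳 × ℝ => φ j z.1) 2 P) {θ : Fin d → ℝ}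
    (hH : ∀ x, |linComb φ θ x - linComb φ θ₀ x| ≤ H) :
    MemLp (fun z => lossDiff lam z (linComb φ θ) (linComb φ θ₀)) 2 P := by
  simp only [lossDiff_eq]
  refine MemLp.const_mul (memLp_mul_two_mul_sub (H := H) (measurable_linComb hφ _) ?_
    (memLp_residual hY hφ2 θ₀)) _
  simpa only [linComb_sub] using hH

theorem integral_lossDiff_sq_le (hY : MemLp (fun z : 𝒳 × ℝ => z.2) 2 P)
    (hφ : ∀ j, Measurable (φ j)) (hφ2 : ∀ j, MemLp (fun z : 𝒳 × ℝ => φ j z.1) 2 P)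
    (hΘ : Convex ℝ Θ) (hθ₀ : θ₀ ∈ Θ)
    (hmin : ∀ θ ∈ Θ, risk P (linComb φ θ₀) ≤ risk P (linComb φ θ)) (hσ : 0 < σ)
    (hcond : P[fun z : 𝒳 × ℝ => (z.2 - linComb φ θ₀ z.1) ^ 2 |
        MeasurableSpace.comap (Prod.fst : 𝒳 × ℝ → 𝒳) inferInstance] ≤ᵐ[P] fun _ => σ ^ 2)
    {θ : Fin d → ℝ} (hθ : θ ∈ Θ) (hH : ∀ x, |linComb φ θ x - linComb φ θ₀ x| ≤ H) :
    ∫ z, lossDiff lam z (linComb φ θ) (linComb φ θ₀) ^ 2 ∂P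
      ≤ lam ^ 2 * (2 * σ + H) ^ 2 * excessRisk P φ θ₀ θ := by
  simp only [lossDiff_eq, mul_pow (-lam), neg_sq]
  rw [integral_const_mul, mul_assoc]
  refine mul_le_mul_of_nonneg_left ?_ (sq_nonneg _)
  refine (integral_sq_mul_two_mul_sub_sq_le (H := H) hσ (measurable_linComb hφ _) ?_
    (memLp_residual hY hφ2 θ₀) hcond).trans ?_
  · simpa only [linComb_sub] using hH
  · exact mul_le_mul_of_nonneg_left (integral_sq_le_excessRisk hY hφ2 hΘ hθ₀ hmin hθ)
      (sq_nonneg _)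

theorem integrable_truncation (hY : MemLp (fun z : 𝒳 × ℝ => z.2) 2 P) (hφ : ∀ j, Measurable (φ j))
    (hφ2 : ∀ j, MemLp (fun z : 𝒳 × ℝ => φ j z.1) 2 P) {θ θ' : Fin d → ℝ}
    (hH : ∀ x, |linComb φ θ x - linComb φ θ' x| ≤ H) :
    Integrable (fun z => truncation lam φ z θ θ') P := by
  have h := memLp_lossDiff (lam := lam) hY hφ hφ2 hH
  exact ((integrable_const _).sub (h.integrable (by norm_num))).add (h.integrable_sq.const_mul _)

theorem integral_truncation_le (hY : MemLp (fun z : 𝒳 × ℝ => z.2) 2 P)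
    (hφ : ∀ j, Measurable (φ j)) (hφ2 : ∀ j, MemLp (fun z : 𝒳 × ℝ => φ j z.1) 2 P)
    (hΘ : Convex ℝ Θ) (hθ₀ : θ₀ ∈ Θ)
    (hmin : ∀ θ ∈ Θ, risk P (linComb φ θ₀) ≤ risk P (linComb φ θ)) (hσ : 0 < σ)
    (hcond : P[fun z : 𝒳 × ℝ => (z.2 - linComb φ θ₀ z.1) ^ 2 |
        MeasurableSpace.comap (Prod.fst : 𝒳 × ℝ → 𝒳) inferInstance] ≤ᵐ[P] fun _ => σ ^ 2)
    (hH : ∀ θ₁ ∈ Θ, ∀ θ₂ ∈ Θ, ∀ x, |linComb φ θ₁ x - linComb φ θ₂ x| ≤ H)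
    {θ θ' : Fin d → ℝ} (hθ : θ ∈ Θ) (hθ' : θ' ∈ Θ) :
    ∫ z, truncation lam φ z θ θ' ∂P ≤
      Real.exp (-(lam * (1 - lam * (2 * σ + H) ^ 2) * excessRisk P φ θ₀ θ)
        + lam * (1 + lam * (2 * σ + H) ^ 2) * excessRisk P φ θ₀ θ') := by
  have h1 := memLp_lossDiff (lam := lam) hY hφ hφ2 (hH θ hθ θ₀ hθ₀)
  have h2 := memLp_lossDiff (lam := lam) hY hφ hφ2 (hH θ' hθ' θ₀ hθ₀)
  have i1 := h1.integrable (by norm_num)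
  have i2 := h2.integrable (by norm_num)
  have b1 := integral_lossDiff_sq_le (lam := lam) hY hφ hφ2 hΘ hθ₀ hmin hσ hcond hθ
    (hH θ hθ θ₀ hθ₀)
  have b2 := integral_lossDiff_sq_le (lam := lam) hY hφ hφ2 hΘ hθ₀ hmin hσ hcond hθ'
    (hH θ' hθ' θ₀ hθ₀)
  have e1 := integral_lossDiff (θ₀ := θ₀) hY hφ2 lam θ
  have e2 := integral_lossDiff (θ₀ := θ₀) hY hφ2 lam θ'
  set W : 𝒳 × ℝ → ℝ := fun z => lossDiff lam z (linComb φ θ) (linComb φ θ₀) with hW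
  set W' : 𝒳 × ℝ → ℝ := fun z => lossDiff lam z (linComb φ θ') (linComb φ θ₀) with hW'
  -- Passing through `θ₀`, `W(θ, θ') = W - W'`, and `(W - W')² / 2 ≤ W² + W'²` separates the two
  -- parameters. The second moments then change the coefficients `∓λ` of the excess risks into `-λ(1
  -- - η)` and `λ(1 + η)`.
  have hle : ∫ z, truncation lam φ z θ θ' ∂P ≤ ∫ z, (1 - (W z - W' z) + (W z ^ 2 + W' z ^ 2)) ∂P := by
    refine integral_mono (integrable_truncation hY hφ hφ2 (hH θ hθ θ' hθ'))
      (((integrable_const _).sub (i1.sub i2)).add (h1.integrable_sq.add h2.integrable_sq))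
      fun z => ?_
    simp only [truncation]
    rw [lossDiff_sub lam z (linComb φ θ) (linComb φ θ') (linComb φ θ₀)]
    nlinarith [sq_nonneg (W z + W' z)]
  refine hle.trans ?_
  rw [integral_add (f := fun z => 1 - (W z - W' z)) (g := fun z => W z ^ 2 + W' z ^ 2)
      ((integrable_const _).sub (i1.sub i2)) (h1.integrable_sq.add h2.integrable_sq),
    integral_sub (f := fun _ => (1 : ℝ)) (g := fun z => W z - W' z) (integrable_const _)
      (i1.sub i2), integral_sub i1 i2, integral_add h1.integrable_sq h2.integrable_sq]
  refine le_trans ?_ (Real.add_one_le_exp _)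
  simp only [integral_const, probReal_univ, smul_eq_mul, mul_one]
  nlinarith

end LossDiff

end PacBayesLS

namespace PacBayesLS

open MeasureTheory ProbabilityTheory
open scoped ENNReal NNReal

/-! ### The posterior in terms of the abstract criterion -/

section Posterior

variable {𝒳 : Type*} {d n : ℕ} {φ : Fin d → 𝒳 → ℝ} {Θ : Set (Fin d → ℝ)} {lam : ℝ}

/-- The product of the truncated factors over the sample. -/
noncomputable def sampleTruncation (lam : ℝ) (φ : Fin d → 𝒳 → ℝ) (z : Fin n → 𝒳 × ℝ)
    (θ θ' : Fin d → ℝ) : ℝ≥0∞ :=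
  ENNReal.ofReal (∏ i, truncation lam φ (z i) θ θ')

theorem truncation_pos (z : 𝒳 × ℝ) (θ θ' : Fin d → ℝ) : 0 < truncation lam φ z θ θ' :=
  one_half_pos.trans_le (half_le_truncation φ lam z θ θ')

theorem le_sampleTruncation (z : Fin n → 𝒳 × ℝ) (θ θ' : Fin d → ℝ) :
    ENNReal.ofReal ((1 / 2) ^ n) ≤ sampleTruncation lam φ z θ θ' := by
  refine ENNReal.ofReal_le_ofReal ?_
  calc ((1 : ℝ) / 2) ^ n = ∏ _i : Fin n, (1 / 2 : ℝ) := by simp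
    _ ≤ _ := Finset.prod_le_prod (fun _ _ => by norm_num) fun i _ => half_le_truncation φ lam _ θ θ'

theorem inv_sampleTruncation_le (z : Fin n → 𝒳 × ℝ) (θ θ' : Fin d → ℝ) :
    (sampleTruncation lam φ z θ θ')⁻¹ ≤ sampleTruncation lam φ z θ' θ := by
  unfold sampleTruncation
  rw [← ENNReal.ofReal_inv_of_pos (Finset.prod_pos fun i _ => truncation_pos _ _ _),
    ← Finset.prod_inv_distrib]
  exact ENNReal.ofReal_le_ofReal (Finset.prod_le_prod
    (fun i _ => (inv_pos.2 (truncation_pos _ _ _)).le) fun i _ => inv_truncation_le φ lam _ θ θ')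

theorem continuous_truncation (z : 𝒳 × ℝ) :
    Continuous fun q : (Fin d → ℝ) × (Fin d → ℝ) => truncation lam φ z q.1 q.2 := by
  unfold truncation lossDiff linComb
  fun_prop

/-- On a bounded parameter set the product of the truncated factors is bounded. -/
theorem exists_sampleTruncation_le (hc : IsClosed Θ) (hb : Bornology.IsBounded Θ)
    (z : Fin n → 𝒳 × ℝ) :
    ∃ M : ℝ≥0∞, M ≠ ∞ ∧ ∀ θ ∈ Θ, ∀ θ' ∈ Θ, sampleTruncation lam φ z θ θ' ≤ M := by
  have hK : IsCompact Θ := Metric.isCompact_of_isClosed_isBounded hc hb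
  have hcont : Continuous fun q : (Fin d → ℝ) × (Fin d → ℝ) =>
      ∏ i, truncation lam φ (z i) q.1 q.2 :=
    continuous_finsetProd _ fun i _ => continuous_truncation (z i)
  obtain ⟨C, hC⟩ := (hK.prod hK).exists_bound_of_continuousOn hcont.continuousOn
  refine ⟨ENNReal.ofReal C, ENNReal.ofReal_ne_top, fun θ hθ θ' hθ' => ?_⟩
  exact ENNReal.ofReal_le_ofReal ((le_abs_self _).trans (hC (θ, θ') ⟨hθ, hθ'⟩))

theorem ae_mem_uniformDistribution (hc : IsClosed Θ) : ∀ᵐ θ ∂(uniformDistribution Θ), θ ∈ Θ :=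
  ae_cond_mem hc.measurableSet

/-- For a fixed sample, compactness of `Θ` bounds `G` by some `M`; hence the criterion is at least
`1 / M` and its inverse at most `M`. -/
theorem partition_sampleTruncation_ne_top (hc : IsClosed Θ) (hb : Bornology.IsBounded Θ)
    [IsProbabilityMeasure (uniformDistribution Θ)] (z : Fin n → 𝒳 × ℝ) :
    partition (uniformDistribution Θ) (sampleTruncation lam φ) z ≠ ∞ := by
  obtain ⟨M, hM, hle⟩ := exists_sampleTruncation_le (lam := lam) (φ := φ) hc hb z
  refine ne_top_of_le_ne_top hM ?_
  have hmem := ae_mem_uniformDistribution hc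
  calc partition (uniformDistribution Θ) (sampleTruncation lam φ) z
      ≤ ∫⁻ _, M ∂(uniformDistribution Θ) := by
        refine lintegral_mono_ae (hmem.mono fun θ hθ => ENNReal.inv_le_iff_inv_le.1 ?_)
        calc M⁻¹ = ∫⁻ _, M⁻¹ ∂(uniformDistribution Θ) := by simp
          _ ≤ _ := lintegral_mono_ae (hmem.mono fun θ' hθ' =>
            ENNReal.inv_le_inv.2 (hle θ hθ θ' hθ'))
    _ = M := by simp

variable [MeasurableSpace 𝒳]

theorem measurable_sampleTruncation (hφ : ∀ j, Measurable (φ j)) :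
    Measurable fun q : ((Fin n → 𝒳 × ℝ) × (Fin d → ℝ)) × (Fin d → ℝ) =>
      sampleTruncation lam φ q.1.1 q.1.2 q.2 := by
  refine (Finset.measurable_prod _ fun i _ => ?_).ennreal_ofReal
  have hz : Measurable fun q : ((Fin n → 𝒳 × ℝ) × (Fin d → ℝ)) × (Fin d → ℝ) => q.1.1 i :=
    (measurable_pi_apply i).comp measurable_fst.fst
  have hlin : ∀ g : ((Fin n → 𝒳 × ℝ) × (Fin d → ℝ)) × (Fin d → ℝ) → (Fin d → ℝ), Measurable g →
      Measurable fun q => linComb φ (g q) (q.1.1 i).1 := fun g hg =>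
    Finset.measurable_sum _ fun j _ =>
      ((measurable_pi_apply j).comp hg).mul ((hφ j).comp hz.fst)
  have hW : Measurable fun q : ((Fin n → 𝒳 × ℝ) × (Fin d → ℝ)) × (Fin d → ℝ) =>
      lossDiff lam (q.1.1 i) (linComb φ q.1.2) (linComb φ q.2) :=
    (((hz.snd.sub (hlin _ measurable_fst.snd)).pow_const 2).sub
      ((hz.snd.sub (hlin _ measurable_snd)).pow_const 2)).const_mul lam
  exact (hW.const_sub 1).add ((hW.pow_const 2).const_mul _)

theorem measurable_sampleTruncation_right (hφ : ∀ j, Measurable (φ j)) (z : Fin n → 𝒳 × ℝ)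
    (θ : Fin d → ℝ) : Measurable fun θ' => sampleTruncation lam φ z θ θ' :=
  (measurable_sampleTruncation (lam := lam) hφ).comp
    (g := fun q : ((Fin n → 𝒳 × ℝ) × (Fin d → ℝ)) × (Fin d → ℝ) =>
      sampleTruncation lam φ q.1.1 q.1.2 q.2) (f := fun θ' => ((z, θ), θ'))
    measurable_prodMk_left

theorem expEHat_eq (hφ : ∀ j, Measurable (φ j)) (z : Fin n → 𝒳 × ℝ) (θ : Fin d → ℝ) :
    expEHat lam φ Θ z θ
      = (criterion (uniformDistribution Θ) (sampleTruncation lam φ) z θ).toReal := by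
  have h : ∀ θ', 1 / ∏ i, truncation lam φ (z i) θ θ' = ((sampleTruncation lam φ z θ θ')⁻¹).toReal := by
    intro θ'
    rw [sampleTruncation, ENNReal.toReal_inv, ENNReal.toReal_ofReal
      (Finset.prod_nonneg fun i _ => (truncation_pos _ _ _).le), one_div]
  have h2 : expEHat lam φ Θ z θ = ∫ θ', ((sampleTruncation lam φ z θ θ')⁻¹).toReal
      ∂(uniformDistribution Θ) := integral_congr_ae (Filter.Eventually.of_forall h)
  rw [h2, integral_toReal (f := fun θ' => (sampleTruncation lam φ z θ θ')⁻¹)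
    (measurable_sampleTruncation_right hφ z θ).inv.aemeasurable]
  · rfl
  · refine Filter.Eventually.of_forall fun θ' => (ENNReal.inv_ne_top.2 ?_).lt_top
    exact (lt_of_lt_of_le (by simp) (le_sampleTruncation z θ θ')).ne'

/-- The real-valued definition agrees with the extended nonnegative one because criterion and
partition function are positive and finite, so neither the logarithm nor the Bochner integrals take
default values. -/
theorem posterior_apply_eq (hφ : ∀ j, Measurable (φ j)) (hc : IsClosed Θ)
    (hb : Bornology.IsBounded Θ) [IsProbabilityMeasure (uniformDistribution Θ)]
    (z : Fin n → 𝒳 × ℝ) :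
    posterior n lam φ hφ Θ z = (uniformDistribution Θ).withDensity fun θ =>
      (partition (uniformDistribution Θ) (sampleTruncation lam φ) z)⁻¹ *
        (criterion (uniformDistribution Θ) (sampleTruncation lam φ) z θ)⁻¹ := by
  set π := uniformDistribution Θ with hπ
  have hG := measurable_sampleTruncation (n := n) (lam := lam) hφ
  have hm : ENNReal.ofReal ((1 / 2) ^ n) ≠ 0 := by simp
  have hC0 := fun θ => criterion_ne_zero π hG (fun _ _ _ => ENNReal.ofReal_ne_top) z θ
  have hCt := fun θ => criterion_ne_top π hm (le_sampleTruncation (lam := lam) (φ := φ)) z θ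
  have hZ0 := partition_ne_zero (π := π) hG hm le_sampleTruncation z
  have hZt := partition_sampleTruncation_ne_top (lam := lam) (φ := φ) hc hb z
  have hexp : ∀ θ, Real.exp (-eHat lam φ Θ z θ)
      = ((criterion π (sampleTruncation lam φ) z θ)⁻¹).toReal := by
    intro θ
    rw [eHat, expEHat_eq hφ, Real.exp_neg, Real.exp_log (ENNReal.toReal_pos (hC0 θ) (hCt θ)),
      ENNReal.toReal_inv]
  have hint : ∫ θ, Real.exp (-eHat lam φ Θ z θ) ∂π
      = (partition π (sampleTruncation lam φ) z).toReal := by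
    simp_rw [hexp]
    rw [integral_toReal]
    · rfl
    · exact ((measurable_criterion π hG).comp (measurable_prodMk_left (x := z))).inv.aemeasurable
    · exact Filter.Eventually.of_forall fun θ => (ENNReal.inv_ne_top.2 (hC0 θ)).lt_top
  change π.withDensity (fun θ => ENNReal.ofReal (posteriorDensity lam φ Θ z θ)) = _
  congr 1
  funext θ
  rw [posteriorDensity, hexp, hint, div_eq_mul_inv, ← ENNReal.toReal_inv, ← ENNReal.toReal_mul,
    mul_comm, ENNReal.ofReal_toReal]
  exact ENNReal.mul_ne_top (ENNReal.inv_ne_top.2 hZ0) (ENNReal.inv_ne_top.2 (hC0 θ))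

theorem isMarkovKernel_posterior (hφ : ∀ j, Measurable (φ j)) (hc : IsClosed Θ)
    (hb : Bornology.IsBounded Θ) [IsProbabilityMeasure (uniformDistribution Θ)] :
    IsMarkovKernel (posterior n lam φ hφ Θ) := by
  refine ⟨fun z => ⟨?_⟩⟩
  have hG := measurable_sampleTruncation (n := n) (lam := lam) hφ
  have hm : ENNReal.ofReal ((1 / 2) ^ n) ≠ 0 := by simp
  rw [posterior_apply_eq hφ hc hb, withDensity_apply _ MeasurableSet.univ, Measure.restrict_univ,
    lintegral_const_mul
      (f := fun θ => (criterion (uniformDistribution Θ) (sampleTruncation lam φ) z θ)⁻¹) _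
      ((measurable_criterion _ hG).comp (measurable_prodMk_left (x := z))).inv]
  exact ENNReal.inv_mul_cancel (partition_ne_zero hG hm le_sampleTruncation z)
    (partition_sampleTruncation_ne_top hc hb z)

end Posterior

/-! ### Dimension bounds on Laplace transforms and the deviation inequality -/

section Bounds

variable {𝒳 : Type*} [MeasurableSpace 𝒳] {P : Measure (𝒳 × ℝ)} [IsProbabilityMeasure P]
  {d n : ℕ} {φ : Fin d → 𝒳 → ℝ} {θ₀ : Fin d → ℝ} {Θ : Set (Fin d → ℝ)} {H σ lam : ℝ}

/-- Independence turns the expectation of the product into the `n`-th power of the bound for one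
observation. -/
theorem lintegral_sampleTruncation_le (hY : MemLp (fun z : 𝒳 × ℝ => z.2) 2 P)
    (hφ : ∀ j, Measurable (φ j)) (hφ2 : ∀ j, MemLp (fun z : 𝒳 × ℝ => φ j z.1) 2 P)
    (hΘ : Convex ℝ Θ) (hθ₀ : θ₀ ∈ Θ)
    (hmin : ∀ θ ∈ Θ, risk P (linComb φ θ₀) ≤ risk P (linComb φ θ)) (hσ : 0 < σ)
    (hcond : P[fun z : 𝒳 × ℝ => (z.2 - linComb φ θ₀ z.1) ^ 2 |
        MeasurableSpace.comap (Prod.fst : 𝒳 × ℝ → 𝒳) inferInstance] ≤ᵐ[P] fun _ => σ ^ 2)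
    (hH : ∀ θ₁ ∈ Θ, ∀ θ₂ ∈ Θ, ∀ x, |linComb φ θ₁ x - linComb φ θ₂ x| ≤ H)
    {θ θ' : Fin d → ℝ} (hθ : θ ∈ Θ) (hθ' : θ' ∈ Θ) :
    ∫⁻ z, sampleTruncation lam φ z θ θ' ∂(Measure.pi fun _ : Fin n => P) ≤
      ENNReal.ofReal (Real.exp
        (-(lam * n * (1 - lam * (2 * σ + H) ^ 2) * excessRisk P φ θ₀ θ)
          + lam * n * (1 + lam * (2 * σ + H) ^ 2) * excessRisk P φ θ₀ θ')) := by
  have hi : Integrable (fun z => truncation lam φ z θ θ') P :=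
    integrable_truncation hY hφ hφ2 (hH θ hθ θ' hθ')
  have hle := integral_truncation_le (lam := lam) hY hφ hφ2 hΘ hθ₀ hmin hσ hcond hH hθ hθ'
  unfold sampleTruncation
  rw [← ofReal_integral_eq_lintegral_ofReal (Integrable.fintype_prod fun _ => hi)
    (Filter.Eventually.of_forall fun z => Finset.prod_nonneg fun i _ => (truncation_pos _ _ _).le),
    integral_fintype_prod_eq_prod (μ := fun _ => P) (fun _ z => truncation lam φ z θ θ')]
  refine ENNReal.ofReal_le_ofReal ?_
  rw [Finset.prod_const, Finset.card_univ, Fintype.card_fin]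
  refine (pow_le_pow_left₀ (integral_nonneg fun z => (truncation_pos _ _ _).le) hle n).trans
    (le_of_eq ?_)
  rw [← Real.exp_nat_mul]
  congr 1
  ring

theorem laplace_uniformDistribution_le (hφ : ∀ j, Measurable (φ j)) (hc : IsClosed Θ)
    (hΘ : Convex ℝ Θ) (hθ₀ : θ₀ ∈ Θ) {a b c : ℝ} (hc0 : 0 < c) (hc1 : c ≤ 1)
    (h : ∀ θ ∈ Θ, b * excessRisk P φ θ₀ (AffineMap.homothety θ₀ c θ) ≤ a * excessRisk P φ θ₀ θ) :
    laplace (uniformDistribution Θ) (excessRisk P φ θ₀) a ≤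
      ENNReal.ofReal ((c ^ d)⁻¹) * laplace (uniformDistribution Θ) (excessRisk P φ θ₀) b := by
  have hD := measurable_excessRisk (P := P) hφ θ₀
  refine lintegral_uniformDistribution_le hc hΘ hθ₀ hc0 hc1 (by fun_prop) fun θ hθ => ?_
  exact ENNReal.ofReal_le_ofReal (Real.exp_le_exp.2 (neg_le_neg (h θ hθ)))

theorem laplace_le_rpow (hY : MemLp (fun z : 𝒳 × ℝ => z.2) 2 P) (hφ : ∀ j, Measurable (φ j))
    (hφ2 : ∀ j, MemLp (fun z : 𝒳 × ℝ => φ j z.1) 2 P) (hc : IsClosed Θ) (hΘ : Convex ℝ Θ)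
    (hθ₀ : θ₀ ∈ Θ) {a b : ℝ} (ha : 0 < a) (hab : a ≤ b) :
    laplace (uniformDistribution Θ) (excessRisk P φ θ₀) a ≤ ENNReal.ofReal ((b / a) ^ (d : ℝ)) *
      laplace (uniformDistribution Θ) (excessRisk P φ θ₀) b := by
  have hb : 0 < b := ha.trans_le hab
  have h := laplace_uniformDistribution_le (P := P) (a := a) (b := b) (c := a / b) hφ hc hΘ hθ₀
    (by positivity) ((div_le_one hb).2 hab) fun θ _ => ?_
  · rwa [← inv_pow, inv_div, ← Real.rpow_natCast] at h
  · have h1 := mul_le_mul_of_nonneg_left (excessRisk_homothety_le (θ₀ := θ₀) hY hφ2 θ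
      (c := a / b) (by positivity) ((div_le_one hb).2 hab)) hb.le
    rwa [← mul_assoc, mul_div_cancel₀ _ hb.ne'] at h1

/-- The excess risk is homogeneous of degree 2 around a global minimizer, so the contraction ratio
can be `√(a / b)` instead of `a / b`. -/
theorem laplace_le_rpow_half (hY : MemLp (fun z : 𝒳 × ℝ => z.2) 2 P)
    (hφ : ∀ j, Measurable (φ j)) (hφ2 : ∀ j, MemLp (fun z : 𝒳 × ℝ => φ j z.1) 2 P)
    (hc : IsClosed Θ) (hΘ : Convex ℝ Θ) (hθ₀ : θ₀ ∈ Θ)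
    (hmin : ∀ θ, risk P (linComb φ θ₀) ≤ risk P (linComb φ θ)) {a b : ℝ} (ha : 0 < a)
    (hab : a ≤ b) :
    laplace (uniformDistribution Θ) (excessRisk P φ θ₀) a ≤
      ENNReal.ofReal ((b / a) ^ ((d : ℝ) / 2)) *
        laplace (uniformDistribution Θ) (excessRisk P φ θ₀) b := by
  have hb : 0 < b := ha.trans_le hab
  have h := laplace_uniformDistribution_le (P := P) (a := a) (b := b) (c := √(a / b)) hφ hc hΘ hθ₀
    (by positivity) (Real.sqrt_le_one.2 ((div_le_one hb).2 hab)) fun θ _ => ?_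
  · rwa [← inv_pow, ← Real.sqrt_inv, inv_div, Real.sqrt_eq_rpow, ← Real.rpow_natCast,
      ← Real.rpow_mul (by positivity), one_div_mul_eq_div] at h
  · rw [excessRisk_homothety_eq hY hφ2 hmin, Real.sq_sqrt (by positivity), ← mul_assoc,
      mul_div_cancel₀ _ hb.ne']

/-- The deviation bound, for an effective dimension `δ` that controls the growth of the Laplace
transform of the excess risk. -/
theorem le_jointLaw_excessRisk_le (hY : MemLp (fun z : 𝒳 × ℝ => z.2) 2 P)
    (hφ : ∀ j, Measurable (φ j)) (hφ2 : ∀ j, MemLp (fun z : 𝒳 × ℝ => φ j z.1) 2 P)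
    (hc : IsClosed Θ) (hΘ : Convex ℝ Θ) (hb : Bornology.IsBounded Θ) (hθ₀ : θ₀ ∈ Θ)
    (hmin : ∀ θ ∈ Θ, risk P (linComb φ θ₀) ≤ risk P (linComb φ θ)) (hσ : 0 < σ)
    (hcond : P[fun z : 𝒳 × ℝ => (z.2 - linComb φ θ₀ z.1) ^ 2 |
        MeasurableSpace.comap (Prod.fst : 𝒳 × ℝ → 𝒳) inferInstance] ≤ᵐ[P] fun _ => σ ^ 2)
    (hH : ∀ θ₁ ∈ Θ, ∀ θ₂ ∈ Θ, ∀ x, |linComb φ θ₁ x - linComb φ θ₂ x| ≤ H) (hn : 1 ≤ n)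
    {δ : ℝ} (hδ : ∀ a b : ℝ, 0 < a → a ≤ b →
      laplace (uniformDistribution Θ) (excessRisk P φ θ₀) a ≤ ENNReal.ofReal ((b / a) ^ δ) *
        laplace (uniformDistribution Θ) (excessRisk P φ θ₀) b)
    {η η' ε t : ℝ} (hlam : 0 < lam) (hη : η = lam * (2 * σ + H) ^ 2) (hη'0 : 0 < η')
    (hη' : η' < 1 - η) (hε : 0 < ε)
    (ht : Real.log ((1 + η) ^ 2 / (η' * (1 - η))) * δ + 2 * Real.log (2 * ε⁻¹)
      ≤ lam * n * (1 - η - η') * t) :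
    ENNReal.ofReal (1 - ε) ≤ jointLaw P n lam φ hφ Θ {ω | excessRisk P φ θ₀ ω.2 ≤ t} := by
  have : IsProbabilityMeasure (uniformDistribution Θ) :=
    isProbabilityMeasure_uniformDistribution hΘ hb ⟨θ₀, hθ₀⟩
  have : IsMarkovKernel (posterior n lam φ hφ Θ) := isMarkovKernel_posterior hφ hc hb
  have hn0 : (0 : ℝ) < n := by exact_mod_cast hn
  have hη0 : 0 ≤ η := by rw [hη]; positivity
  have h1η : 0 < 1 - η := hη'0.trans hη'
  have hmem := ae_mem_uniformDistribution hc
  have hbad : jointLaw P n lam φ hφ Θ {ω | t < excessRisk P φ θ₀ ω.2} ≤ ENNReal.ofReal ε := by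
    -- The choice of `c` leaves `a - c = λ n η'`, so the two ratios of Laplace transforms are
    -- controlled by `b / a = (1 + η) / (1 - η)` and `b / (a - c) = (1 + η) / η'`.
    refine compProd_deviation_le (π := uniformDistribution Θ) (G := sampleTruncation lam φ)
      (m := ENNReal.ofReal ((1 / 2) ^ n)) (a := lam * n * (1 - η)) (b := lam * n * (1 + η))
      (c := lam * n * (1 - η - η')) (s := Θ)
      (ρ₁ := ((1 + η) / (1 - η)) ^ δ) (ρ₂ := ((1 + η) / η') ^ δ)
      (measurable_sampleTruncation hφ) (fun _ _ _ => ENNReal.ofReal_ne_top) (by simp)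
      le_sampleTruncation inv_sampleTruncation_le (partition_sampleTruncation_ne_top hc hb)
      (measurable_excessRisk hφ θ₀) (hmem.mono fun θ hθ => sub_nonneg.2 (hmin θ hθ))
      (by positivity) hmem ?_ _ (posterior_apply_eq hφ hc hb) ?_ hε (by positivity)
      (by positivity) ?_ ?_ ?_
    · intro θ hθ θ' hθ'
      rw [hη]
      exact lintegral_sampleTruncation_le hY hφ hφ2 hΘ hθ₀ hmin hσ hcond hH hθ hθ'
    · have : 0 < 1 - η - η' := by linarith
      positivity
    · have h := hδ (lam * n * (1 - η)) (lam * n * (1 + η)) (by positivity) (by gcongr; linarith)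
      rwa [mul_div_mul_left _ _ (by positivity)] at h
    · have e : lam * n * (1 - η) - lam * n * (1 - η - η') = lam * n * η' := by ring
      have h := hδ (lam * n * η') (lam * n * (1 + η)) (by positivity) (by gcongr; linarith)
      rw [e]
      rwa [mul_div_mul_left _ _ (by positivity)] at h
    · rw [← Real.mul_rpow (by positivity) (by positivity)]
      have e : (1 + η) / (1 - η) * ((1 + η) / η') = (1 + η) ^ 2 / (η' * (1 - η)) := by
        field_simp
      have hX : 0 < (1 + η) ^ 2 / (η' * (1 - η)) := by positivity
      rw [e, Real.rpow_def_of_pos hX, div_eq_mul_inv 2 ε]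
      refine le_trans (le_of_eq ?_) (Real.exp_le_exp.2 ht)
      rw [add_comm, Real.exp_add, two_mul (Real.log _), Real.exp_add,
        Real.exp_log (by positivity)]
      ring
  have huniv : ({ω | excessRisk P φ θ₀ ω.2 ≤ t} ∪ {ω | t < excessRisk P φ θ₀ ω.2} :
      Set ((Fin n → 𝒳 × ℝ) × (Fin d → ℝ))) = Set.univ := by
    ext ω
    simpa using le_or_gt _ _
  have hprob : jointLaw P n lam φ hφ Θ Set.univ = 1 := by
    unfold jointLaw
    exact measure_univ
  rw [ENNReal.ofReal_sub _ hε.le, ENNReal.ofReal_one, tsub_le_iff_right, ← hprob, ← huniv]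
  exact (measure_union_le _ _).trans (by gcongr)

end Bounds

/-! ### Numerical constants -/

/-- This is `C₁ ≤ 16.6` at `η = 0.32`, `η' = 0.18`, where `η (1 - η - η') = 0.16`. The two sides
differ by less than `0.001`, hence the long Taylor sum. -/
theorem log_numeric_bound :
    Real.log ((1 + 0.32) ^ 2 / (0.18 * (1 - 0.32))) ≤ 16.6 * 0.16 := by
  rw [Real.log_le_iff_le_exp (by norm_num)]
  have h := Real.sum_le_exp_of_nonneg (x := 16.6 * 0.16) (by norm_num) 14
  refine le_trans ?_ h
  simp only [Finset.sum_range_succ, Finset.sum_range_zero, Nat.factorial]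
  norm_num

theorem two_mul_add_pos {𝒳 : Type*} [MeasurableSpace 𝒳] (P : Measure (𝒳 × ℝ))
    [IsProbabilityMeasure P] {f : 𝒳 → ℝ} {H σ : ℝ} (hH : ∀ x, |f x| ≤ H) (hσ : 0 < σ) :
    0 < 2 * σ + H := by
  obtain ⟨z⟩ := nonempty_of_isProbabilityMeasure P
  have := (abs_nonneg _).trans (hH z.1)
  linarith

end PacBayesLS

/-! ### The theorem -/

open MeasureTheory PacBayesLS
theorem theorem2p1 {𝒳 : Type*} [MeasurableSpace 𝒳]
    (P : Measure (𝒳 × ℝ)) [IsProbabilityMeasure P]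
    (hY : MemLp (fun z : 𝒳 × ℝ => z.2) 2 P)
    {d : ℕ} (φ : Fin d → 𝒳 → ℝ) (hφ : ∀ j, Measurable (φ j))
    (hφ2 : ∀ j, MemLp (fun z : 𝒳 × ℝ => φ j z.1) 2 P)
    (Θ : Set (Fin d → ℝ)) (hΘ_closed : IsClosed Θ) (hΘ_convex : Convex ℝ Θ)
    (hΘ_bdd : Bornology.IsBounded Θ)
    (θstar : Fin d → ℝ) (hθstar : θstar ∈ Θ)
    (hmin : ∀ θ ∈ Θ, risk P (linComb φ θstar) ≤ risk P (linComb φ θ))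
    (H σ : ℝ)
    (hH : ∀ θ₁ ∈ Θ, ∀ θ₂ ∈ Θ, ∀ x, |linComb φ θ₁ x - linComb φ θ₂ x| ≤ H)
    (hσ : 0 < σ)
    (hcond : P[fun z : 𝒳 × ℝ => (z.2 - linComb φ θstar z.1) ^ 2 |
        MeasurableSpace.comap (Prod.fst : 𝒳 × ℝ → 𝒳) inferInstance] ≤ᵐ[P] fun _ => σ ^ 2)
    (n : ℕ) (hn : 1 ≤ n) :
    (∀ lam η' ε : ℝ, 0 < lam → 0 < η' → η' < 1 - lam * (2 * σ + H) ^ 2 → 0 < ε →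
      ∀ η C₁ C₂ : ℝ, η = lam * (2 * σ + H) ^ 2 →
        C₁ = Real.log ((1 + η) ^ 2 / (η' * (1 - η))) / (η * (1 - η - η')) →
        C₂ = 2 / (η * (1 - η - η')) →
        ENNReal.ofReal (1 - ε) ≤ jointLaw P n lam φ hφ Θ
          {ω | risk P (linComb φ ω.2) - risk P (linComb φ θstar)
            ≤ (2 * σ + H) ^ 2 * ((C₁ * d + C₂ * Real.log (2 * ε⁻¹)) / n)}) ∧
    (∀ lam ε : ℝ, lam = 0.32 * ((2 * σ + H) ^ 2)⁻¹ → 0 < ε →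
      ENNReal.ofReal (1 - ε) ≤ jointLaw P n lam φ hφ Θ
        {ω | risk P (linComb φ ω.2) - risk P (linComb φ θstar)
          ≤ (2 * σ + H) ^ 2 * ((16.6 * d + 12.5 * Real.log (2 * ε⁻¹)) / n)}) ∧
    ((∀ θ : Fin d → ℝ, risk P (linComb φ θstar) ≤ risk P (linComb φ θ)) →
      ∀ lam ε : ℝ, lam = 0.32 * ((2 * σ + H) ^ 2)⁻¹ → 0 < ε →
        ENNReal.ofReal (1 - ε) ≤ jointLaw P n lam φ hφ Θ
          {ω | risk P (linComb φ ω.2) - risk P (linComb φ θstar)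
            ≤ (2 * σ + H) ^ 2 * ((8.3 * d + 12.5 * Real.log (2 * ε⁻¹)) / n)}) := by
  have hs : 0 < 2 * σ + H := two_mul_add_pos P (hH θstar hθstar θstar hθstar) hσ
  have hs2 : 0 < (2 * σ + H) ^ 2 := by positivity
  have hn0 : (0 : ℝ) < n := by exact_mod_cast hn
  -- The last two claims differ only in the effective dimension: `δ = d` gives `16.6`, `δ = d / 2`
  -- gives `8.3`. In both, `2 / 0.16 = 12.5`.
  have hspecial : ∀ δ C : ℝ, 0 ≤ δ → C * d = 16.6 * δ →
      (∀ a b : ℝ, 0 < a → a ≤ b →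
        laplace (uniformDistribution Θ) (excessRisk P φ θstar) a ≤ ENNReal.ofReal ((b / a) ^ δ) *
          laplace (uniformDistribution Θ) (excessRisk P φ θstar) b) →
      ∀ lam ε : ℝ, lam = 0.32 * ((2 * σ + H) ^ 2)⁻¹ → 0 < ε →
        ENNReal.ofReal (1 - ε) ≤ jointLaw P n lam φ hφ Θ
          {ω | risk P (linComb φ ω.2) - risk P (linComb φ θstar)
            ≤ (2 * σ + H) ^ 2 * ((C * d + 12.5 * Real.log (2 * ε⁻¹)) / n)} := by
    intro δ C hδ0 hC hδ lam ε hlam hε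
    have hη : (0.32 : ℝ) = lam * (2 * σ + H) ^ 2 := by
      rw [hlam]
      field_simp
    refine le_jointLaw_excessRisk_le (η' := 0.18) hY hφ hφ2 hΘ_closed hΘ_convex hΘ_bdd hθstar hmin
      hσ hcond hH hn hδ (by rw [hlam]; positivity) hη (by norm_num) (by norm_num) hε ?_
    have e : lam * n * (1 - 0.32 - 0.18) *
        ((2 * σ + H) ^ 2 * ((C * d + 12.5 * Real.log (2 * ε⁻¹)) / n))
        = 16.6 * 0.16 * δ + 2 * Real.log (2 * ε⁻¹) := by
      rw [hC, hlam]
      field_simp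
      ring
    rw [e]
    gcongr
    exact log_numeric_bound
  refine ⟨?_, ?_, ?_⟩
  · intro lam η' ε hlam hη'0 hη' hε η C₁ C₂ hη hC₁ hC₂
    have hη0 : 0 < η := by rw [hη]; positivity
    have h1 : 0 < 1 - η - η' := by rw [hη]; linarith
    refine le_jointLaw_excessRisk_le hY hφ hφ2 hΘ_closed hΘ_convex hΘ_bdd hθstar hmin hσ hcond hH
      hn (fun a b => laplace_le_rpow hY hφ hφ2 hΘ_closed hΘ_convex hθstar) hlam hη hη'0
      (by linarith) hε (le_of_eq ?_)
    have e : lam * n * (1 - η - η') *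
        ((2 * σ + H) ^ 2 * ((C₁ * d + C₂ * Real.log (2 * ε⁻¹)) / n))
        = η * (1 - η - η') * (C₁ * d + C₂ * Real.log (2 * ε⁻¹)) := by
      rw [hη]
      field_simp
    rw [e, hC₁, hC₂]
    field_simp
  · exact hspecial d 16.6 (by positivity) rfl fun a b =>
      laplace_le_rpow hY hφ hφ2 hΘ_closed hΘ_convex hθstar
  · intro hglob
    exact hspecial (d / 2) 8.3 (by positivity) (by ring) fun a b =>
      laplace_le_rpow_half hY hφ hφ2 hΘ_closed hΘ_convex hθstar hglob
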